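/- Let $d,n\ge 1$ be integers. The connected framed blob monoid $Bl_{d,n}^c$ is the monoid presented by generators $u_0,\dots,u_{n-1},z_0,z_1,\dots,z_n$ and the relations (for all indices for which the generators exist): * (blob) $u_i^2=u_i$; $u_iu_j=u_ju_i$ if $|i-j|>1$; $u_1u_0u_1=u_1$; $u_iu_ju_i=u_i$ if $|i-j|=1$ and $i,j\neq 0$; * (framing) $z_i^d=1$, $z_iz_j=z_jz_i$; * (mixed) $z_iu_i=z_{i+1}u_i$, $u_iz_i=u_iz_{i+1}$ (also for $i=0$); $u_iz_j=z_ju_i$ if $j\neq i,i+1$; $z_0u_0=u_0z_0$; $u_iz_i^ku_i=u_i$ for $i\ne 0$, $k\ge 0$. In the partition monoid on the points $0,1,\dots,n$ (top) and $0',1',\dots,n'$ (bottom), with the product by concatenation, let $\underline U_0$ be the partition with blocks $\{0,1,0',1'\}$ and $\{k,k'\}$ for $k\ne 0,1$, and for $1\le i\le n-1$ let $\underline U_i$ be the partition with blocks $\{i,i+1\}$, $\{i',(i+1)'\}$ and $\{k,k'\}$ for $k\neq i,i+1$. The submonoid $\mathfrak H_n$ generated by $\underline U_0,\dots,\underline U_{n-1}$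 is the hook blob monoid, and its elements are the hook diagrams. The abacus hook monoid $\mathfrak H_{d,n}$ consists of all hook diagrams in which each block (arc) carries a number of beads in $\mathbb Z/d\mathbb Z$. The product is concatenation: the number of beads of a block of the product is the sum of the numbers of beads of all blocks of the two factors that lie in the corresponding connected component of the stacked diagram, and components that do not meet the top or bottom points of the stack are erased together with their beads. Let $\mathfrak z_j\in\mathfrak H_{d,n}$ be the identity diagram with one bead on the block $\{j,j'\}$, and let $\mathfrak g_0$ and $\mathfrak u_i$ ($1\le i\le n-1$) be $\underline U_0$ and $\underline U_i$ without beads. Then there is a monoid homomorphism $\psi: Bl_{d,n}^c\to\mathfrak H_{d,n}$ with $\psi(z_j)=\mathfrak z_j$ for $0\le j\le n$, $\psi(u_0)=\mathfrak g_0$ and $\psi(u_i)=\mathfrak u_i$ for $1\le i\le n-1$, and $\psi$ is an isomorphism. In particular, the defining presentation of $Bl_{d,n}^c$ is a presentation of $\mathfrak H_{d,n}$: the elements $\mathfrak z_0,\dots,\mathfrak z_n,\mathfrak g_0,\mathfrak u_1,\dots,\mathfrak u_{n-1}$ generate $\mathfrak H_{d,n}$, and the kernel of the homomorphism from the free monoid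 on the generators onto $\mathfrak H_{d,n}$ is the congruence generated by the relations above. -/

import Mathlib

/-- The generators `u_0, …, u_{n-1}` and `z_0, …, z_n`. -/
inductive BlobGen (n : ℕ) : Type
  | u (i : Fin n)
  | z (j : Fin (n + 1))

namespace BlobGen

/-- `u_i` as a word of length one. -/
def U {n : ℕ} (i : Fin n) : FreeMonoid (BlobGen n) := FreeMonoid.of (u i)

/-- `z_j` as a word of length one. -/
def Z {n : ℕ} (j : Fin (n + 1)) : FreeMonoid (BlobGen n) := FreeMonoid.of (z j)

end BlobGen

open BlobGen in
/-- The defining relations of the connected framed blob monoid. For `i : Fin n`, the indices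
`i` and `i + 1` of the framing generators are `i.castSucc` and `i.succ`. -/
inductive ConnectedFramedBlobRel (d n : ℕ) :
    FreeMonoid (BlobGen n) → FreeMonoid (BlobGen n) → Prop
  -- the relations of the blob monoid
  | u_idem (i : Fin n) : ConnectedFramedBlobRel d n (U i * U i) (U i)
  | u_comm (i j : Fin n) (h : i.val + 1 < j.val ∨ j.val + 1 < i.val) :
      ConnectedFramedBlobRel d n (U i * U j) (U j * U i)
  | u_one_zero_one (i j : Fin n) (hi : i.val = 1) (hj : j.val = 0) :
      ConnectedFramedBlobRel d n (U i * U j * U i) (U i)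
  | u_jones (i j : Fin n) (hi : i.val ≠ 0) (hj : j.val ≠ 0)
      (h : i.val = j.val + 1 ∨ j.val = i.val + 1) :
      ConnectedFramedBlobRel d n (U i * U j * U i) (U i)
  -- the framing relations
  | z_pow (j : Fin (n + 1)) : ConnectedFramedBlobRel d n (Z j ^ d) 1
  | z_comm (j k : Fin (n + 1)) : ConnectedFramedBlobRel d n (Z j * Z k) (Z k * Z j)
  -- the mixed relations
  | z_slide_left (i : Fin n) :
      ConnectedFramedBlobRel d n (Z i.castSucc * U i) (Z i.succ * U i)
  | z_slide_right (i : Fin n) :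
      ConnectedFramedBlobRel d n (U i * Z i.castSucc) (U i * Z i.succ)
  | u_z_comm (i : Fin n) (j : Fin (n + 1)) (h : j ≠ i.castSucc) (h' : j ≠ i.succ) :
      ConnectedFramedBlobRel d n (U i * Z j) (Z j * U i)
  | z_zero_u_zero (i : Fin n) (hi : i.val = 0) :
      ConnectedFramedBlobRel d n (Z 0 * U i) (U i * Z 0)
  | u_loop (i : Fin n) (hi : i.val ≠ 0) (k : ℕ) :
      ConnectedFramedBlobRel d n (U i * Z i.castSucc ^ k * U i) (U i)

/-- The connected framed blob monoid. -/
abbrev ConnectedFramedBlob (d n : ℕ) : Type := PresentedMonoid (ConnectedFramedBlobRel d n)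

/-- A partition diagram on the points `X`: a partition of a top copy (`Sum.inl`) and a bottom copy
(`Sum.inr`) of `X`, given as an equivalence relation. -/
@[ext]
structure PartitionDiagram (X : Type*) where
  rel : Setoid (X ⊕ X)

namespace PartitionDiagram

variable {X : Type*}

/-- The blocks of the partition. -/
def Block (P : PartitionDiagram X) : Type _ := Quotient P.rel

/-- The block that contains a point. -/
def block (P : PartitionDiagram X) (v : X ⊕ X) : P.Block := Quotient.mk P.rel v

theorem block_eq {P : PartitionDiagram X} {v w : X ⊕ X} : P.block v = P.block w ↔ P.rel v w :=
  Quotient.eq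

theorem block_surjective (P : PartitionDiagram X) : Function.Surjective P.block :=
  Quotient.exists_rep

/-- Three layers of points, from top to bottom, are `X ⊕ X ⊕ X`; this embeds the top and bottom
points of the upper one of two stacked diagrams. -/
def upper : X ⊕ X → X ⊕ X ⊕ X := Sum.elim Sum.inl (Sum.inr ∘ Sum.inl)

/-- The points of the lower one of two stacked diagrams. -/
def lower : X ⊕ X → X ⊕ X ⊕ X := Sum.inr

/-- The points that remain after the middle layer has been removed. -/
def outer : X ⊕ X → X ⊕ X ⊕ X := Sum.elim Sum.inl (Sum.inr ∘ Sum.inr)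

/-- The connected components of `P` stacked on top of `Q`. -/
def stack (P Q : PartitionDiagram X) : Setoid (X ⊕ X ⊕ X) := P.rel.map upper ⊔ Q.rel.map lower

/-- The partition into vertical lines `{x, x'}`. -/
instance : One (PartitionDiagram X) := ⟨⟨Setoid.ker (Sum.elim id id)⟩⟩

/-- The product by concatenation: stack, then keep the connections between the outer points. -/
instance : Mul (PartitionDiagram X) := ⟨fun P Q => ⟨(stack P Q).comap outer⟩⟩

theorem one_rel {v w : X ⊕ X} :
    (1 : PartitionDiagram X).rel v w ↔ Sum.elim id id v = (Sum.elim id id w : X) := Iff.rfl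

theorem mul_rel {P Q : PartitionDiagram X} {v w : X ⊕ X} :
    (P * Q).rel v w ↔ stack P Q (outer v) (outer w) := Iff.rfl

theorem stack_upper {P Q : PartitionDiagram X} {v w : X ⊕ X} (h : P.rel v w) :
    stack P Q (upper v) (upper w) :=
  (le_sup_left : P.rel.map upper ≤ stack P Q) (Relation.EqvGen.rel _ _ ⟨v, w, h, rfl, rfl⟩)

theorem stack_lower {P Q : PartitionDiagram X} {v w : X ⊕ X} (h : Q.rel v w) :
    stack P Q (lower v) (lower w) :=
  (le_sup_right : Q.rel.map lower ≤ stack P Q) (Relation.EqvGen.rel _ _ ⟨v, w, h, rfl, rfl⟩)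

theorem stack_le {P Q : PartitionDiagram X} {s : Setoid (X ⊕ X ⊕ X)}
    (hP : ∀ v w, P.rel v w → s (upper v) (upper w))
    (hQ : ∀ v w, Q.rel v w → s (lower v) (lower w)) : stack P Q ≤ s := by
  refine sup_le (Setoid.eqvGen_le ?_) (Setoid.eqvGen_le ?_)
  · rintro _ _ ⟨v, w, h, rfl, rfl⟩; exact hP v w h
  · rintro _ _ ⟨v, w, h, rfl, rfl⟩; exact hQ v w h

/-- A function that is constant on the blocks of both diagrams is constant on components. -/
theorem stack_ker {α : Type*} {P Q : PartitionDiagram X} (φ : X ⊕ X ⊕ X → α)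
    (hP : ∀ v w, P.rel v w → φ (upper v) = φ (upper w))
    (hQ : ∀ v w, Q.rel v w → φ (lower v) = φ (lower w)) {a b : X ⊕ X ⊕ X}
    (h : stack P Q a b) : φ a = φ b :=
  stack_le (s := Setoid.ker φ) hP hQ h

/-- The component of the stack that contains a given block of the upper diagram. -/
def upperComponent (P Q : PartitionDiagram X) : P.Block → Quotient (stack P Q) :=
  Quotient.map' upper fun _ _ h => stack_upper h

/-- The component of the stack that contains a given block of the lower diagram. -/
def lowerComponent (P Q : PartitionDiagram X) : Q.Block → Quotient (stack P Q) :=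
  Quotient.map' lower fun _ _ h => stack_lower h

/-- The component of the stack from which a block of the product arises. -/
def outerComponent (P Q : PartitionDiagram X) : (P * Q).Block → Quotient (stack P Q) :=
  Quotient.map' outer fun _ _ h => h

theorem upper_outer {P Q : PartitionDiagram X} {v w : X ⊕ X} :
    upperComponent P Q (P.block v) = outerComponent P Q ((P * Q).block w) ↔
      stack P Q (upper v) (outer w) := Quotient.eq

theorem lower_outer {P Q : PartitionDiagram X} {v w : X ⊕ X} :
    lowerComponent P Q (Q.block v) = outerComponent P Q ((P * Q).block w) ↔
      stack P Q (lower v) (outer w) := Quotient.eq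

/-! Unit laws. -/

theorem stack_one_left {P : PartitionDiagram X} {a b : X ⊕ X ⊕ X} :
    stack 1 P a b ↔ P.rel (Sum.elim Sum.inl id a) (Sum.elim Sum.inl id b) := by
  have key : ∀ a : X ⊕ X ⊕ X, stack 1 P a (lower (Sum.elim Sum.inl id a)) := by
    rintro (x | a)
    · exact stack_upper (v := Sum.inl x) (w := Sum.inr x) (one_rel.2 rfl)
    · exact Setoid.refl' _ _
  constructor
  · intro h
    have := stack_ker (P := 1) (Q := P) (fun a => P.block (Sum.elim Sum.inl id a)) (by
      rintro (v | v) (w | w) h <;> obtain rfl : v = w := h <;> rfl) (by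
      intro v w h; exact block_eq.2 h) h
    exact block_eq.1 this
  · intro h
    exact Setoid.trans' _ (key a) (Setoid.trans' _ (stack_lower h) (Setoid.symm' _ (key b)))

theorem stack_one_right {P : PartitionDiagram X} {a b : X ⊕ X ⊕ X} :
    stack P 1 a b ↔ P.rel (Sum.elim Sum.inl (Sum.inr ∘ Sum.elim id id) a)
      (Sum.elim Sum.inl (Sum.inr ∘ Sum.elim id id) b) := by
  have key : ∀ a : X ⊕ X ⊕ X,
      stack P 1 a (upper (Sum.elim Sum.inl (Sum.inr ∘ Sum.elim id id) a)) := by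
    rintro (x | x | x)
    · exact Setoid.refl' _ _
    · exact Setoid.refl' _ _
    · exact stack_lower (v := Sum.inr x) (w := Sum.inl x) (one_rel.2 rfl)
  constructor
  · intro h
    have := stack_ker (P := P) (Q := 1)
      (fun a => P.block (Sum.elim Sum.inl (Sum.inr ∘ Sum.elim id id) a)) (by
      rintro (v | v) (w | w) h <;> exact block_eq.2 h) (by
      rintro (v | v) (w | w) h <;> obtain rfl : v = w := h <;> rfl) h
    exact block_eq.1 this
  · intro h
    exact Setoid.trans' _ (key a) (Setoid.trans' _ (stack_upper h) (Setoid.symm' _ (key b)))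

theorem one_mul' (P : PartitionDiagram X) : 1 * P = P := by
  ext v w
  rw [mul_rel, stack_one_left]
  rcases v with v | v <;> rcases w with w | w <;> rfl

theorem mul_one' (P : PartitionDiagram X) : P * 1 = P := by
  ext v w
  rw [mul_rel, stack_one_right]
  rcases v with v | v <;> rcases w with w | w <;> rfl

/-! Associativity, by comparison with the stack of three diagrams. -/

/-- The components of the stack of `P`, `Q` and `R`, on four layers. -/
def stack₃ (P Q R : PartitionDiagram X) : Setoid (X ⊕ X ⊕ X ⊕ X) :=
  ((stack P Q).map (Sum.map id (Sum.map id Sum.inl))) ⊔ ((stack Q R).map Sum.inr)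

/-- The outer layers of four. -/
def outer₃ : X ⊕ X → X ⊕ X ⊕ X ⊕ X := Sum.map id (Sum.inr ∘ Sum.inr)

theorem stack₃_left {P Q R : PartitionDiagram X} {a b : X ⊕ X ⊕ X} (h : stack P Q a b) :
    stack₃ P Q R (Sum.map id (Sum.map id Sum.inl) a) (Sum.map id (Sum.map id Sum.inl) b) :=
  (le_sup_left : (stack P Q).map (Sum.map id (Sum.map id Sum.inl)) ≤ stack₃ P Q R)
    (Relation.EqvGen.rel _ _ ⟨a, b, h, rfl, rfl⟩)

theorem stack₃_right {P Q R : PartitionDiagram X} {a b : X ⊕ X ⊕ X} (h : stack Q R a b) :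
    stack₃ P Q R (Sum.inr a) (Sum.inr b) :=
  (le_sup_right : (stack Q R).map Sum.inr ≤ stack₃ P Q R)
    (Relation.EqvGen.rel _ _ ⟨a, b, h, rfl, rfl⟩)

theorem stack₃_ker {α : Type*} {P Q R : PartitionDiagram X} (φ : X ⊕ X ⊕ X ⊕ X → α)
    (hP : ∀ a b, stack P Q a b → φ (Sum.map id (Sum.map id Sum.inl) a) =
      φ (Sum.map id (Sum.map id Sum.inl) b))
    (hQ : ∀ a b, stack Q R a b → φ (Sum.inr a) = φ (Sum.inr b)) {a b : X ⊕ X ⊕ X ⊕ X}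
    (h : stack₃ P Q R a b) : φ a = φ b := by
  have : stack₃ P Q R ≤ Setoid.ker φ := by
    refine sup_le (Setoid.eqvGen_le ?_) (Setoid.eqvGen_le ?_)
    · rintro _ _ ⟨v, w, h, rfl, rfl⟩; exact hP v w h
    · rintro _ _ ⟨v, w, h, rfl, rfl⟩; exact hQ v w h
  exact this h

theorem outer_class {P Q R : PartitionDiagram X} {c c' : X ⊕ X}
    (h : stack P Q (outer c) (outer c')) : stack (P * Q) R (upper c) (upper c') :=
  stack_upper h

/-- An inner point of the two upper diagrams reaches a point of `(P * Q) * R` only through one of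
the outer points of `P * Q`. -/
theorem stack₃_left_aux (P Q R : PartitionDiagram X) :
    (∀ t a, stack₃ P Q R (Sum.map id (Sum.map id Sum.inl) t) (Sum.map id Sum.inr a) ↔
      ∃ c, stack (P * Q) R (upper c) a ∧ stack P Q t (outer c)) ∧
    (∀ a b, stack₃ P Q R (Sum.map id Sum.inr a) (Sum.map id Sum.inr b) ↔
      stack (P * Q) R a b) := by
  let φ : X ⊕ X ⊕ X ⊕ X → Set (Quotient (stack (P * Q) R)) :=
    Sum.elim (fun x => {q | ∃ c, stack P Q (Sum.inl x) (outer c) ∧ q = Quotient.mk _ (upper c)})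
      (Sum.elim (fun x => {q | ∃ c, stack P Q (Sum.inr (Sum.inl x)) (outer c) ∧
          q = Quotient.mk _ (upper c)})
        (fun b => {Quotient.mk _ (Sum.inr b)}))
  have hout : ∀ c₀ : X ⊕ X, ({Quotient.mk _ (upper c₀)} : Set (Quotient (stack (P * Q) R))) =
      {q | ∃ c, stack P Q (outer c₀) (outer c) ∧ q = Quotient.mk _ (upper c)} := by
    intro c₀
    ext q
    constructor
    · intro h; exact ⟨c₀, Setoid.refl' _ _, h⟩
    · rintro ⟨c, h, rfl⟩
      exact Quotient.sound (Setoid.symm' _ (outer_class h))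
  have hφ : ∀ t, φ (Sum.map id (Sum.map id Sum.inl) t) =
      {q | ∃ c, stack P Q t (outer c) ∧ q = Quotient.mk _ (upper c)} := by
    rintro (x | x | x)
    · rfl
    · rfl
    · exact hout (Sum.inr x)
  have hφ' : ∀ a, φ (Sum.map id Sum.inr a) = {Quotient.mk _ a} := by
    rintro (x | x)
    · exact (hout (Sum.inl x)).symm
    · rfl
  have hPQ : ∀ a b, stack P Q a b → φ (Sum.map id (Sum.map id Sum.inl) a) =
      φ (Sum.map id (Sum.map id Sum.inl) b) := by
    intro a b h
    rw [hφ, hφ]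
    ext q
    constructor
    · rintro ⟨c, hc, hq⟩; exact ⟨c, Setoid.trans' _ (Setoid.symm' _ h) hc, hq⟩
    · rintro ⟨c, hc, hq⟩; exact ⟨c, Setoid.trans' _ h hc, hq⟩
  have hker : ∀ {a b}, stack₃ P Q R a b → φ a = φ b := fun h =>
    stack₃_ker φ hPQ (fun a b hab => stack_ker (fun a => φ (Sum.inr a)) (by
      intro v w hvw
      have := hPQ _ _ (stack_lower (P := P) hvw)
      rcases v with v | v <;> rcases w with w | w <;> exact this) (by
      intro v w hvw
      have h₂ : (Quotient.mk (stack (P * Q) R) (lower v)) = Quotient.mk _ (lower w) :=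
        Quotient.sound (stack_lower hvw)
      exact congrArg (fun q => ({q} : Set _)) h₂) hab) h
  have hle : stack (P * Q) R ≤ (stack₃ P Q R).comap (Sum.map id Sum.inr) := by
    refine stack_le ?_ ?_
    · intro v w h
      have := stack₃_left (R := R) (mul_rel.1 h)
      rcases v with v | v <;> rcases w with w | w <;> exact this
    · intro v w h
      exact stack₃_right (P := P) (stack_lower h)
  refine ⟨fun t a => ⟨fun h => ?_, ?_⟩, fun a b => ⟨fun h => ?_, fun h => hle h⟩⟩
  · have h₁ := hker h
    rw [hφ, hφ'] at h₁
    obtain ⟨c, hc, hq⟩ := h₁.ge (Set.mem_singleton _)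
    exact ⟨c, Setoid.symm' _ (Quotient.exact hq), hc⟩
  · rintro ⟨c, hc, ht⟩
    refine Setoid.trans' _ (stack₃_left (R := R) ht) ?_
    have h₂ := hle hc
    rcases c with c | c <;> exact h₂
  · have h₁ := hker h
    rw [hφ', hφ'] at h₁
    exact Quotient.exact (Set.singleton_injective h₁)

/-- An inner point of the two lower diagrams reaches a point of `P * (Q * R)` only through one of
the outer points of `Q * R`. -/
theorem stack₃_right_aux (P Q R : PartitionDiagram X) :
    (∀ t a, stack₃ P Q R (Sum.inr t) (Sum.map id outer a) ↔
      ∃ c, stack P (Q * R) (lower c) a ∧ stack Q R t (outer c)) ∧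
    (∀ a b, stack₃ P Q R (Sum.map id outer a) (Sum.map id outer b) ↔
      stack P (Q * R) a b) := by
  let φ : X ⊕ X ⊕ X ⊕ X → Set (Quotient (stack P (Q * R))) :=
    Sum.elim (fun x => {Quotient.mk _ (Sum.inl x)})
      (fun t => {q | ∃ c, stack Q R t (outer c) ∧ q = Quotient.mk _ (lower c)})
  have hφ' : ∀ a, φ (Sum.map id outer a) = {Quotient.mk _ a} := by
    rintro (x | c₀)
    · rfl
    · ext q
      constructor
      · rintro ⟨c, h, rfl⟩
        exact Quotient.sound (Setoid.symm' _ (stack_lower (P := P) (mul_rel.2 h)))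
      · intro h; exact ⟨c₀, Setoid.refl' _ _, h⟩
  have hQR : ∀ a b, stack Q R a b → φ (Sum.inr a) = φ (Sum.inr b) := by
    intro a b h
    ext q
    constructor
    · rintro ⟨c, hc, hq⟩; exact ⟨c, Setoid.trans' _ (Setoid.symm' _ h) hc, hq⟩
    · rintro ⟨c, hc, hq⟩; exact ⟨c, Setoid.trans' _ h hc, hq⟩
  have hker : ∀ {a b}, stack₃ P Q R a b → φ a = φ b := fun h =>
    stack₃_ker φ (fun a b hab =>
      stack_ker (fun a => φ (Sum.map id (Sum.map id Sum.inl) a)) (by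
        intro v w hvw
        have h₂ : (Quotient.mk (stack P (Q * R)) (upper v)) = Quotient.mk _ (upper w) :=
          Quotient.sound (stack_upper hvw)
        have h₃ : φ (Sum.map id outer (upper v)) = φ (Sum.map id outer (upper w)) := by
          rw [hφ', hφ', h₂]
        rcases v with v | v <;> rcases w with w | w <;> exact h₃) (by
        intro v w hvw
        have h₃ := hQR _ _ (stack_upper (Q := R) hvw)
        rcases v with v | v <;> rcases w with w | w <;> exact h₃) hab) hQR h
  have hle : stack P (Q * R) ≤ (stack₃ P Q R).comap (Sum.map id outer) := by
    refine stack_le ?_ ?_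
    · intro v w h
      have := stack₃_left (R := R) (stack_upper (Q := Q) h)
      rcases v with v | v <;> rcases w with w | w <;> exact this
    · intro v w h
      exact stack₃_right (P := P) (mul_rel.1 h)
  refine ⟨fun t a => ⟨fun h => ?_, ?_⟩, fun a b => ⟨fun h => ?_, fun h => hle h⟩⟩
  · have h₁ := hker h
    rw [hφ'] at h₁
    obtain ⟨c, hc, hq⟩ := h₁.ge (Set.mem_singleton _)
    exact ⟨c, Setoid.symm' _ (Quotient.exact hq), hc⟩
  · rintro ⟨c, hc, ht⟩
    exact Setoid.trans' _ (stack₃_right ht) (hle hc)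
  · have h₁ := hker h
    rw [hφ', hφ'] at h₁
    exact Quotient.exact (Set.singleton_injective h₁)

theorem mul_assoc' (P Q R : PartitionDiagram X) : P * Q * R = P * (Q * R) := by
  ext v w
  have h₁ := (stack₃_left_aux P Q R).2 (outer v) (outer w)
  have h₂ := (stack₃_right_aux P Q R).2 (outer v) (outer w)
  refine h₁.symm.trans (Iff.trans ?_ h₂)
  rcases v with v | v <;> rcases w with w | w <;> rfl

/-- The partition monoid. -/
instance : Monoid (PartitionDiagram X) where
  mul_assoc := mul_assoc'
  one_mul := one_mul'
  mul_one := mul_one'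

theorem outerComponent_injective (P Q : PartitionDiagram X) :
    Function.Injective (outerComponent P Q) := by
  intro b c
  obtain ⟨v, rfl⟩ := block_surjective _ b
  obtain ⟨w, rfl⟩ := block_surjective _ c
  intro h
  exact block_eq.2 (mul_rel.2 (Quotient.exact (s := stack P Q) h))

noncomputable instance [Finite X] (P : PartitionDiagram X) : Fintype P.Block :=
  haveI : Finite P.Block := inferInstanceAs (Finite (Quotient P.rel))
  Fintype.ofFinite _

end PartitionDiagram

/-- A partition diagram each of whose blocks carries a number of beads, counted in `G`. -/
structure BeadedDiagram (X G : Type*) where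
  base : PartitionDiagram X
  beads : base.Block → G

namespace BeadedDiagram

open PartitionDiagram

variable {X G : Type*}

theorem ext' {D E : BeadedDiagram X G} (h : D.base = E.base)
    (hb : ∀ v, D.beads (D.base.block v) = E.beads (E.base.block v)) : D = E := by
  obtain ⟨P, f⟩ := D
  obtain ⟨Q, g⟩ := E
  obtain rfl : P = Q := h
  obtain rfl : f = g := funext fun b => by
    obtain ⟨v, rfl⟩ := block_surjective _ b
    exact hb v
  rfl

/-- The vertical lines without beads. -/
instance [Zero G] : One (BeadedDiagram X G) := ⟨⟨1, fun _ => 0⟩⟩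

@[simp] theorem one_base [Zero G] : (1 : BeadedDiagram X G).base = 1 := rfl

variable [Finite X] [AddCommMonoid G]

open scoped Classical in
/-- The product by concatenation. Beads slide freely along the components of the stack, so a block
of the product carries all the beads of the blocks of both factors that lie in its component.
Components that do not meet the outer points are erased together with their beads. -/
noncomputable instance : Mul (BeadedDiagram X G) :=
  ⟨fun D E =>
    { base := D.base * E.base
      beads := fun b =>
        (∑ c : D.base.Block,
          if upperComponent D.base E.base c = outerComponent D.base E.base b
            then D.beads c else 0) +
        ∑ c : E.base.Block,
          if lowerComponent D.base E.base c = outerComponent D.base E.base b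
            then E.beads c else 0 }⟩

@[simp] theorem mul_base (D E : BeadedDiagram X G) : (D * E).base = D.base * E.base := rfl

open scoped Classical in
theorem mul_beads (D E : BeadedDiagram X G) (b : (D.base * E.base).Block) :
    (D * E).beads b =
      (∑ c : D.base.Block,
        if upperComponent D.base E.base c = outerComponent D.base E.base b
          then D.beads c else 0) +
      ∑ c : E.base.Block,
        if lowerComponent D.base E.base c = outerComponent D.base E.base b
          then E.beads c else 0 := rfl

open scoped Classical in
theorem sum_collapse {ι κ : Type*} [Fintype ι] [Fintype κ] (w : ι → G) (p : κ → Prop)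
    (r : ι → κ → Prop) (s : ι → Prop) (hr : ∀ i k k', r i k → r i k' → k = k')
    (hs : ∀ i, s i ↔ ∃ k, p k ∧ r i k) :
    (∑ k, if p k then (∑ i, if r i k then w i else 0) else 0) = ∑ i, if s i then w i else 0 := by
  have : ∀ k, (if p k then (∑ i, if r i k then w i else 0) else 0) =
      ∑ i, if p k ∧ r i k then w i else 0 := by
    intro k
    by_cases h : p k <;> simp [h]
  simp_rw [this]
  rw [Finset.sum_comm]
  refine Finset.sum_congr rfl fun i _ => ?_
  by_cases h : s i
  · obtain ⟨k, hp, hk⟩ := (hs i).1 h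
    rw [if_pos h, Finset.sum_eq_single k, if_pos ⟨hp, hk⟩]
    · intro k' _ hne
      exact if_neg fun h' => hne (hr i _ _ h'.2 hk)
    · simp
  · rw [if_neg h]
    exact Finset.sum_eq_zero fun k _ => if_neg fun h' => h ((hs i).2 ⟨k, h'⟩)

open scoped Classical in
theorem one_mul' (D : BeadedDiagram X G) : 1 * D = D := by
  refine ext' (one_mul D.base) fun v => ?_
  have h : ∀ c : D.base.Block,
      lowerComponent 1 D.base c = outerComponent 1 D.base ((1 * D.base).block v) ↔
        c = D.base.block v := by
    intro c
    obtain ⟨w, rfl⟩ := block_surjective _ c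
    rw [lower_outer, stack_one_left, block_eq]
    rcases v with v | v <;> rfl
  change (∑ c : (1 : PartitionDiagram X).Block,
      if upperComponent 1 D.base c = outerComponent 1 D.base ((1 * D.base).block v)
        then (0 : G) else 0) +
    (∑ c : D.base.Block,
      if lowerComponent 1 D.base c = outerComponent 1 D.base ((1 * D.base).block v)
        then D.beads c else 0) = _
  simp [h]

open scoped Classical in
theorem mul_one' (D : BeadedDiagram X G) : D * 1 = D := by
  refine ext' (mul_one D.base) fun v => ?_
  have h : ∀ c : D.base.Block,
      upperComponent D.base 1 c = outerComponent D.base 1 ((D.base * 1).block v) ↔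
        c = D.base.block v := by
    intro c
    obtain ⟨w, rfl⟩ := block_surjective _ c
    rw [upper_outer, stack_one_right, block_eq]
    rcases v with v | v <;> rcases w with w | w <;> rfl
  change (∑ c : D.base.Block,
      if upperComponent D.base 1 c = outerComponent D.base 1 ((D.base * 1).block v)
        then D.beads c else 0) +
    (∑ c : (1 : PartitionDiagram X).Block,
      if lowerComponent D.base 1 c = outerComponent D.base 1 ((D.base * 1).block v)
        then (0 : G) else 0) = _
  simp [h]

open scoped Classical in
theorem mul_assoc' (D E F : BeadedDiagram X G) : D * E * F = D * (E * F) := by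
  refine ext' (mul_assoc D.base E.base F.base) fun v => ?_
  obtain ⟨P, d⟩ := D
  obtain ⟨Q, e⟩ := E
  obtain ⟨R, f⟩ := F
  -- both sides are the total over the components of the triple stack
  let T := stack₃ P Q R
  let o : Quotient T := Quotient.mk T (outer₃ v)
  let cP : P.Block → Quotient T :=
    Quotient.map' (Sum.map id (Sum.map id Sum.inl) ∘ upper) fun _ _ h =>
      stack₃_left (stack_upper h)
  let cQ : Q.Block → Quotient T :=
    Quotient.map' (Sum.inr ∘ upper) fun _ _ h => stack₃_right (stack_upper h)
  let cR : R.Block → Quotient T :=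
    Quotient.map' (Sum.inr ∘ lower) fun _ _ h => stack₃_right (stack_lower h)
  have L := stack₃_left_aux P Q R
  have M := stack₃_right_aux P Q R
  have oL : Sum.map id Sum.inr (outer v) = outer₃ v := by rcases v with v | v <;> rfl
  have oM : Sum.map id outer (outer v) = outer₃ v := by rcases v with v | v <;> rfl
  have hL : ∀ t, T (Sum.map id (Sum.map id Sum.inl) t) (outer₃ v) ↔
      ∃ c : (P * Q).Block, upperComponent (P * Q) R c =
        outerComponent (P * Q) R ((P * Q * R).block v) ∧
        Quotient.mk (stack P Q) t = outerComponent P Q c := by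
    intro t
    rw [← oL]
    refine (L.1 t (outer v)).trans ⟨?_, ?_⟩
    · rintro ⟨c, h₁, h₂⟩
      exact ⟨(P * Q).block c, Quotient.sound h₁, Quotient.sound h₂⟩
    · rintro ⟨c, h₁, h₂⟩
      obtain ⟨c, rfl⟩ := block_surjective _ c
      exact ⟨c, upper_outer.1 h₁, Quotient.exact h₂⟩
  have hM : ∀ t, T (Sum.inr t) (outer₃ v) ↔
      ∃ c : (Q * R).Block, lowerComponent P (Q * R) c =
        outerComponent P (Q * R) ((P * (Q * R)).block v) ∧
        Quotient.mk (stack Q R) t = outerComponent Q R c := by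
    intro t
    rw [← oM]
    refine (M.1 t (outer v)).trans ⟨?_, ?_⟩
    · rintro ⟨c, h₁, h₂⟩
      exact ⟨(Q * R).block c, Quotient.sound h₁, Quotient.sound h₂⟩
    · rintro ⟨c, h₁, h₂⟩
      obtain ⟨c, rfl⟩ := block_surjective _ c
      exact ⟨c, lower_outer.1 h₁, Quotient.exact h₂⟩
  have cP_iff : ∀ w, cP (P.block w) = o ↔
      T (Sum.map id (Sum.map id Sum.inl) (upper w)) (outer₃ v) := fun w => Quotient.eq
  have cQ_iff : ∀ w, cQ (Q.block w) = o ↔ T (Sum.inr (upper w)) (outer₃ v) :=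
    fun w => Quotient.eq
  have cR_iff : ∀ w, cR (R.block w) = o ↔ T (Sum.inr (lower w)) (outer₃ v) :=
    fun w => Quotient.eq
  -- the left bracketing
  have l₁ := sum_collapse d
    (fun c : (P * Q).Block => upperComponent (P * Q) R c =
        outerComponent (P * Q) R ((P * Q * R).block v))
    (fun i c => upperComponent P Q i = outerComponent P Q c) (fun i => cP i = o)
    (fun i k k' h h' => outerComponent_injective P Q (h.symm.trans h')) (fun i => by
      obtain ⟨w, rfl⟩ := block_surjective _ i
      exact (cP_iff w).trans (hL (upper w)))
  have l₂ := sum_collapse e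
    (fun c : (P * Q).Block => upperComponent (P * Q) R c =
        outerComponent (P * Q) R ((P * Q * R).block v))
    (fun i c => lowerComponent P Q i = outerComponent P Q c) (fun i => cQ i = o)
    (fun i k k' h h' => outerComponent_injective P Q (h.symm.trans h')) (fun i => by
      obtain ⟨w, rfl⟩ := block_surjective _ i
      refine (cQ_iff w).trans (Iff.trans ?_ (hL (lower w)))
      rcases w with w | w <;> rfl)
  have l₃ : ∀ i, lowerComponent (P * Q) R i = outerComponent (P * Q) R ((P * Q * R).block v) ↔
      cR i = o := by
    intro i
    obtain ⟨w, rfl⟩ := block_surjective _ i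
    refine lower_outer.trans (Iff.trans ?_ (cR_iff w).symm)
    rw [← oL]
    exact (L.2 (lower w) (outer v)).symm
  -- the right bracketing
  have m₁ : ∀ i, upperComponent P (Q * R) i = outerComponent P (Q * R) ((P * (Q * R)).block v) ↔
      cP i = o := by
    intro i
    obtain ⟨w, rfl⟩ := block_surjective _ i
    refine upper_outer.trans (Iff.trans ?_ (cP_iff w).symm)
    rw [← oM]
    refine (M.2 (upper w) (outer v)).symm.trans ?_
    rcases w with w | w <;> rfl
  have m₂ := sum_collapse e
    (fun c : (Q * R).Block => lowerComponent P (Q * R) c =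
        outerComponent P (Q * R) ((P * (Q * R)).block v))
    (fun i c => upperComponent Q R i = outerComponent Q R c) (fun i => cQ i = o)
    (fun i k k' h h' => outerComponent_injective Q R (h.symm.trans h')) (fun i => by
      obtain ⟨w, rfl⟩ := block_surjective _ i
      exact (cQ_iff w).trans (hM (upper w)))
  have m₃ := sum_collapse f
    (fun c : (Q * R).Block => lowerComponent P (Q * R) c =
        outerComponent P (Q * R) ((P * (Q * R)).block v))
    (fun i c => lowerComponent Q R i = outerComponent Q R c) (fun i => cR i = o)
    (fun i k k' h h' => outerComponent_injective Q R (h.symm.trans h')) (fun i => by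
      obtain ⟨w, rfl⟩ := block_surjective _ i
      exact (cR_iff w).trans (hM (lower w)))
  have split : ∀ (p : Prop) [Decidable p] (a b : G),
      (if p then a + b else 0) = (if p then a else 0) + (if p then b else 0) := by
    intro p _ a b; by_cases h : p <;> simp [h]
  change
    (∑ c : (P * Q).Block, if upperComponent (P * Q) R c =
        outerComponent (P * Q) R ((P * Q * R).block v) then
      ((∑ i, if upperComponent P Q i = outerComponent P Q c then d i else 0) +
        ∑ i, if lowerComponent P Q i = outerComponent P Q c then e i else 0) else 0) +
    (∑ i, if lowerComponent (P * Q) R i = outerComponent (P * Q) R ((P * Q * R).block v)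
      then f i else 0) =
    (∑ i, if upperComponent P (Q * R) i = outerComponent P (Q * R) ((P * (Q * R)).block v)
      then d i else 0) +
    (∑ c : (Q * R).Block, if lowerComponent P (Q * R) c =
        outerComponent P (Q * R) ((P * (Q * R)).block v) then
      ((∑ i, if upperComponent Q R i = outerComponent Q R c then e i else 0) +
        ∑ i, if lowerComponent Q R i = outerComponent Q R c then f i else 0) else 0)
  simp only [split, Finset.sum_add_distrib, l₃, m₁]
  have key := (congrArg₂ (· + ·) (congrArg₂ (· + ·) l₁ l₂)
    (Eq.refl _)).trans ((add_assoc _ _ _).trans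
      (congrArg₂ (· + ·) (Eq.refl _)
        (congrArg₂ (· + ·) m₂ m₃)).symm)
  convert key

/-- The monoid of all beaded partition diagrams. -/
noncomputable instance : Monoid (BeadedDiagram X G) where
  mul_assoc := mul_assoc'
  one_mul := one_mul'
  mul_one := mul_one'

/-- Erasing the beads. -/
def baseHom : BeadedDiagram X G →* PartitionDiagram X where
  toFun := base
  map_one' := rfl
  map_mul' _ _ := rfl

end BeadedDiagram

/-- For the point labels `0, …, n`, a label of the block of `hookGen i` that contains a point. -/
def hookLabel {n : ℕ} (i : Fin n) : Fin (n + 1) ⊕ Fin (n + 1) → Fin (n + 1) ⊕ Fin (n + 1)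
  | .inl k => if k = i.succ then .inl i.castSucc else .inl k
  | .inr k =>
      if k = i.castSucc ∨ k = i.succ then
        if i.val = 0 then .inl i.castSucc else .inr i.castSucc
      else .inl k

/-- The diagram `U_i` on the points `0, …, n`: for `i = 0` its blocks are `{0, 1, 0', 1'}` and the
lines `{k, k'}` with `k ≠ 0, 1`; for `i ≠ 0` its blocks are `{i, i + 1}`, `{i', (i + 1)'}` and the
lines `{k, k'}` with `k ≠ i, i + 1`. -/
def hookGen {n : ℕ} (i : Fin n) : PartitionDiagram (Fin (n + 1)) :=
  ⟨Setoid.ker (hookLabel i)⟩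

/-- The hook blob monoid; its elements are the hook diagrams. -/
def HookBlob (n : ℕ) : Submonoid (PartitionDiagram (Fin (n + 1))) :=
  Submonoid.closure (Set.range hookGen)

/-- The abacus hook monoid: all hook diagrams with beads, counted modulo `d`, on their arcs (an
arc is a block of the diagram; all arcs connected to `0` and `0'` form a single one). -/
noncomputable def AbacusHook (d n : ℕ) : Submonoid (BeadedDiagram (Fin (n + 1)) (ZMod d)) :=
  (HookBlob n).comap BeadedDiagram.baseHom

namespace AbacusHook

/-- The diagram `U_i` without beads. -/
def u (d : ℕ) {n : ℕ} (i : Fin n) : AbacusHook d n :=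
  ⟨⟨hookGen i, fun _ => 0⟩, Submonoid.subset_closure ⟨i, rfl⟩⟩

open scoped Classical in
/-- The vertical lines, with one bead on the line `{j, j'}`. -/
noncomputable def z (d : ℕ) {n : ℕ} (j : Fin (n + 1)) : AbacusHook d n :=
  ⟨⟨1, fun b => if b = (1 : PartitionDiagram (Fin (n + 1))).block (.inl j) then 1 else 0⟩,
    (HookBlob n).one_mem⟩

/-- The images of the generators of the connected framed blob monoid. -/
noncomputable def gen (d n : ℕ) : BlobGen n → AbacusHook d n
  | .u i => u d i
  | .z j => z d j

end AbacusHook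

/-!
The relations are checked in the abacus hook monoid (`abacus_relations`), which gives the
homomorphism `abacusHom`. The work is to show that it is bijective. Both halves rest on writing the
elements of the presented monoid as words in the blob generators with beads added at the ends.

*Words in the blob generators are determined by their diagrams* (`IsHookFamily.eq_of_map_eq`). Let
`v 0, v 1, …` be the blob generators. Every product of `v 0, …, v m` can be written as
`v k * v (k + 1) * ⋯ * v m * b` with `0 ≤ k ≤ m + 1` and `b` a product of `v 0, …, v (m - 1)`
(`Run`, `IsBlobFamily.exists_run`). With this form at hand, induction shows that arcs of the diagram
can be read back as letters: if the diagram of `x` has the upper arc `{i, i + 1}` with `i ≠ 0`, then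
`v i * x = x` (`mul_eq_of_hook`), and there are two similar statements for the block of the point
`0` (`mul_eq_of_zero_one`, `mul_eq_of_zero_two`). Now let `x` and `x'` have the same diagram. If the
form of `x` starts with `v k`, then both of them absorb `v k`, and multiplication by `v (k + 1)`, …,
`v m` moves the common arc to the right margin; this is undone by the Jones relations and, for
`k = 0`, by `mul_eq_of_zero_two`. There
`x = v m * b` and `x' = v m * b'` with `b` and `b'` products of `v 0, …, v (m - 1)`, and the diagram
of `v m * b` is that of `b` with one end point bent around the margin (`rel_bend`). Hence `b` and
`b'` have the same diagram, and induction on `m` applies.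

*Beads.* A bead can be moved along the block on which it lies (`addBead_congr`): this needs to be
checked for single generators only, since the components of a stack are generated by the blocks of
its layers. Therefore beads can be moved past a generator, unless they lie on a component that the
generator closes. In that case the word below has a small upper arc there, so it absorbs the
generator, and the relation `u_loop` erases the beads (`exists_u_mul_addBeads`). For this one uses
that a block of a hook diagram without the point `0` has exactly two points
(`HookBlob.exists_partner`). Hence every element is a word in the blob generators with beads added
at the outer points. It depends only on the word and on the number of beads on each block modulo `d`
(`addBeads_congr`), and these data are exactly what its image in the abacus hook monoid records.
-/

/-! ### Multiplying a diagram by a generator from above -/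

namespace PartitionDiagram

variable {X : Type*}

/-- The partition obtained from `D` by joining the blocks of `p` and `q`. -/
def link (D : PartitionDiagram X) (p q : X ⊕ X) : Setoid (X ⊕ X) where
  r v w := D.rel v w ∨ (D.rel v p ∧ D.rel q w) ∨ (D.rel v q ∧ D.rel p w)
  iseqv := by
    have S : ∀ {a b}, D.rel a b → D.rel b a := fun h => Setoid.symm' _ h
    have T : ∀ {a b c}, D.rel a b → D.rel b c → D.rel a c := fun h h' => Setoid.trans' _ h h'
    refine ⟨fun v => .inl (Setoid.refl' _ v), ?_, ?_⟩
    · rintro v w (h | ⟨h, h'⟩ | ⟨h, h'⟩)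
      · exact .inl (S h)
      · exact .inr (.inr ⟨S h', S h⟩)
      · exact .inr (.inl ⟨S h', S h⟩)
    · rintro v w x (h | ⟨h, h'⟩ | ⟨h, h'⟩) (k | ⟨k, k'⟩ | ⟨k, k'⟩)
      · exact .inl (T h k)
      · exact .inr (.inl ⟨T h k, k'⟩)
      · exact .inr (.inr ⟨T h k, k'⟩)
      · exact .inr (.inl ⟨h, T h' k⟩)
      · exact .inl (T h (T (T (S k) (S h')) k'))
      · exact .inl (T h k')
      · exact .inr (.inr ⟨h, T h' k⟩)
      · exact .inl (T h k')
      · exact .inl (T h (T (T (S k) (S h')) k'))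

theorem link_rel {D : PartitionDiagram X} {p q v w : X ⊕ X} :
    D.link p q v w ↔ D.rel v w ∨ (D.rel v p ∧ D.rel q w) ∨ (D.rel v q ∧ D.rel p w) := Iff.rfl

end PartitionDiagram

open PartitionDiagram

variable {n : ℕ}

theorem hookGen_rel {i : Fin n} {v w : Fin (n + 1) ⊕ Fin (n + 1)} :
    (hookGen i).rel v w ↔ hookLabel i v = hookLabel i w := Iff.rfl

/-- The two upper end points of the generator `hookGen i`. -/
def IsHookEnd (i : Fin n) (v : Fin (n + 1) ⊕ Fin (n + 1)) : Prop :=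
  v = .inl i.castSucc ∨ v = .inl i.succ

theorem stack_hookGen_outer {i : Fin n} {D : PartitionDiagram (Fin (n + 1))}
    {v : Fin (n + 1) ⊕ Fin (n + 1)} (h : ¬ IsHookEnd i v) :
    stack (hookGen i) D (outer v) (lower v) := by
  rcases v with k | k
  · refine stack_upper (v := .inl k) (w := .inr k) ?_
    simp only [IsHookEnd, Sum.inl.injEq, not_or] at h
    simp [hookGen_rel, hookLabel, h]
  · exact Setoid.refl' _ _

theorem stack_hookGen_pair (i : Fin n) (D : PartitionDiagram (Fin (n + 1))) :
    stack (hookGen i) D (lower (.inl i.castSucc)) (lower (.inl i.succ)) := by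
  refine stack_upper (v := .inr i.castSucc) (w := .inr i.succ) ?_
  simp [hookGen_rel, hookLabel]

theorem stack_hookGen_link {i : Fin n} {D : PartitionDiagram (Fin (n + 1))}
    {v w : Fin (n + 1) ⊕ Fin (n + 1)}
    (h : D.link (.inl i.castSucc) (.inl i.succ) v w) :
    stack (hookGen i) D (lower v) (lower w) := by
  have hp := stack_hookGen_pair i D
  rcases h with h | ⟨h, h'⟩ | ⟨h, h'⟩
  · exact stack_lower h
  · exact Setoid.trans' _ (stack_lower h) (Setoid.trans' _ hp (stack_lower h'))
  · exact Setoid.trans' _ (stack_lower h)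
      (Setoid.trans' _ (Setoid.symm' _ hp) (stack_lower h'))

/-- Multiplying by `hookGen i`, `i ≠ 0`, from above caps off the points `i` and `i + 1`: their
blocks are joined, and the points themselves become the ends of a new arc. -/
theorem hookGen_mul_rel {i : Fin n} (hi : i.val ≠ 0) {D : PartitionDiagram (Fin (n + 1))}
    {v w : Fin (n + 1) ⊕ Fin (n + 1)} :
    (hookGen i * D).rel v w ↔ (IsHookEnd i v ∧ IsHookEnd i w) ∨
      (¬ IsHookEnd i v ∧ ¬ IsHookEnd i w ∧
        D.link (.inl i.castSucc) (.inl i.succ) v w) := by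
  classical
  have hne : i.castSucc ≠ i.succ := (Fin.castSucc_lt_succ).ne
  constructor
  · intro h
    let φ : Fin (n + 1) ⊕ Fin (n + 1) ⊕ Fin (n + 1) →
        Option (Quotient (D.link (.inl i.castSucc) (.inl i.succ))) :=
      Sum.elim (fun k => if IsHookEnd i (.inl k) then none else some (Quotient.mk _ (.inl k)))
        (fun v => some (Quotient.mk _ v))
    have hφ : ∀ v, φ (outer v) = if IsHookEnd i v then none else some (Quotient.mk _ v) := by
      rintro (k | k)
      · rfl
      · simp [φ, outer, IsHookEnd]
    have key := stack_ker φ (P := hookGen i) (Q := D) (by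
      have hp : (Quotient.mk (D.link (.inl i.castSucc) (.inl i.succ)) (.inl i.castSucc)) =
          Quotient.mk _ (.inl i.succ) :=
        Quotient.sound (.inr (.inl ⟨Setoid.refl' _ _, Setoid.refl' _ _⟩))
      intro v w hvw
      change hookLabel i v = hookLabel i w at hvw
      rcases v with v | v <;> rcases w with w | w <;>
        simp only [hookLabel, hi, if_false] at hvw <;>
        simp only [φ, upper, IsHookEnd, Sum.elim_inl, Sum.elim_inr, Function.comp, Sum.inl.injEq]
          <;> grind) (by
      intro v w hvw
      exact congrArg some (Quotient.sound (.inl hvw))) h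
    rw [hφ, hφ] at key
    by_cases hv : IsHookEnd i v <;> by_cases hw : IsHookEnd i w <;> simp [hv, hw] at key ⊢
    exact Quotient.exact key
  · rintro (⟨hv, hw⟩ | ⟨hv, hw, h⟩)
    · refine mul_rel.2 ?_
      obtain rfl | rfl := hv <;> obtain rfl | rfl := hw <;>
        first
        | exact Setoid.refl' _ _
        | exact stack_upper (v := .inl _) (w := .inl _)
            (by simp [hookGen_rel, hookLabel])
    · exact mul_rel.2 (Setoid.trans' _ (stack_hookGen_outer hv)
        (Setoid.trans' _ (stack_hookGen_link h) (Setoid.symm' _ (stack_hookGen_outer hw))))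

/-- Multiplying by `hookGen 0` from above joins the blocks of `0` and `1`. -/
theorem hookGen_zero_mul_rel {i : Fin n} (hi : i.val = 0) {D : PartitionDiagram (Fin (n + 1))}
    {v w : Fin (n + 1) ⊕ Fin (n + 1)} :
    (hookGen i * D).rel v w ↔ D.link (.inl i.castSucc) (.inl i.succ) v w := by
  classical
  have hne : i.castSucc ≠ i.succ := (Fin.castSucc_lt_succ).ne
  constructor
  · intro h
    let φ : Fin (n + 1) ⊕ Fin (n + 1) ⊕ Fin (n + 1) →
        Quotient (D.link (.inl i.castSucc) (.inl i.succ)) :=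
      Sum.elim (fun k => Quotient.mk _ (.inl k)) (fun v => Quotient.mk _ v)
    have hφ : ∀ v, φ (outer v) = Quotient.mk _ v := by
      rintro (k | k) <;> rfl
    have key := stack_ker φ (P := hookGen i) (Q := D) (by
      have hp : (Quotient.mk (D.link (.inl i.castSucc) (.inl i.succ)) (.inl i.castSucc)) =
          Quotient.mk _ (.inl i.succ) :=
        Quotient.sound (.inr (.inl ⟨Setoid.refl' _ _, Setoid.refl' _ _⟩))
      intro v w hvw
      change hookLabel i v = hookLabel i w at hvw
      rcases v with v | v <;> rcases w with w | w <;>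
        simp only [hookLabel, hi, if_true] at hvw <;>
        simp only [φ, upper, Sum.elim_inl, Sum.elim_inr, Function.comp]
          <;> grind) (by
      intro v w hvw
      exact Quotient.sound (.inl hvw)) h
    rw [hφ, hφ] at key
    exact Quotient.exact key
  · intro h
    have hout : ∀ v, stack (hookGen i) D (outer v) (lower v) := by
      rintro (k | k)
      · refine stack_upper (v := .inl k) (w := .inr k) ?_
        simp only [hookGen_rel, hookLabel]
        grind
      · exact Setoid.refl' _ _
    exact mul_rel.2 (Setoid.trans' _ (hout v)
        (Setoid.trans' _ (stack_hookGen_link h) (Setoid.symm' _ (hout w))))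

theorem hookGen_mul_self (i : Fin n) : hookGen i * hookGen i = hookGen i := by
  have hne : i.castSucc ≠ i.succ := (Fin.castSucc_lt_succ).ne
  ext v w
  by_cases hi : i.val = 0
  · rw [hookGen_zero_mul_rel hi, link_rel]
    have h : (hookGen i).rel (.inl i.castSucc) (.inl i.succ) := by simp [hookGen_rel, hookLabel]
    simp only [hookGen_rel] at h ⊢
    grind
  · rw [hookGen_mul_rel hi, link_rel]
    have h : ∀ v, IsHookEnd i v ↔ hookLabel i v = .inl i.castSucc := by
      rintro (k | k) <;> simp [IsHookEnd, hookLabel, hi] <;> grind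
    simp only [h, hookGen_rel]
    simp [hookLabel]
    grind

theorem hookGen_mul_comm (i j : Fin n) (h : i.val + 1 < j.val) :
    hookGen i * hookGen j = hookGen j * hookGen i := by
  have hj : j.val ≠ 0 := by omega
  have h₁ : i.castSucc ≠ i.succ := by simp [Fin.ext_iff]
  have h₂ : j.castSucc ≠ j.succ := by simp [Fin.ext_iff]
  have h₃ : i.castSucc ≠ j.castSucc := by simp [Fin.ext_iff]; omega
  have h₄ : i.castSucc ≠ j.succ := by simp [Fin.ext_iff]; omega
  have h₅ : i.succ ≠ j.castSucc := by simp [Fin.ext_iff]; omega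
  have h₆ : i.succ ≠ j.succ := by simp [Fin.ext_iff]; omega
  ext v w
  by_cases hi : i.val = 0
  · rw [hookGen_mul_rel hj, hookGen_zero_mul_rel hi]
    simp only [link_rel, hookGen_rel, IsHookEnd]
    rcases v with v | v <;> rcases w with w | w <;>
      simp only [hookLabel, hi, hj, if_true, if_false] <;> grind
  · rw [hookGen_mul_rel hj, hookGen_mul_rel hi]
    simp only [link_rel, hookGen_rel, IsHookEnd]
    rcases v with v | v <;> rcases w with w | w <;>
      simp only [hookLabel, hi, hj, if_false] <;> grind

/-- Neighbouring generators satisfy the Jones relation, also for the pair `1, 0`. -/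
theorem hookGen_mul_jones (i j : Fin n) (hi : i.val ≠ 0)
    (h : i.val = j.val + 1 ∨ j.val = i.val + 1) :
    hookGen i * hookGen j * hookGen i = hookGen i := by
  have h₁ : i.castSucc ≠ i.succ := by simp [Fin.ext_iff]
  have h₂ : j.castSucc ≠ j.succ := by simp [Fin.ext_iff]
  have h₃ : i.castSucc ≠ j.castSucc := by simp [Fin.ext_iff]; omega
  have h₆ : i.succ ≠ j.succ := by simp [Fin.ext_iff]; omega
  ext v w
  rw [mul_assoc, hookGen_mul_rel hi]
  rcases h with h | h
  · have h₄ : i.castSucc = j.succ := by simp [Fin.ext_iff]; omega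
    have h₅ : i.succ ≠ j.castSucc := by simp [Fin.ext_iff]; omega
    by_cases hj : j.val = 0
    · simp only [link_rel, hookGen_zero_mul_rel hj, hookGen_rel, IsHookEnd]
      rcases v with v | v <;> rcases w with w | w <;>
      simp only [hookLabel, hi, if_true, if_false] <;> grind
    · simp only [link_rel, hookGen_mul_rel hj, hookGen_rel, IsHookEnd]
      rcases v with v | v <;> rcases w with w | w <;>
      simp only [hookLabel, hi, if_true, if_false] <;> grind
  · have h₄ : i.castSucc ≠ j.succ := by simp [Fin.ext_iff]; omega
    have h₅ : i.succ = j.castSucc := by simp [Fin.ext_iff]; omega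
    have hj : j.val ≠ 0 := by omega
    simp only [link_rel, hookGen_mul_rel hj, hookGen_rel, IsHookEnd]
    rcases v with v | v <;> rcases w with w | w <;>
      simp only [hookLabel, hi, if_true, if_false] <;> grind

/-! ### Beaded diagrams and the homomorphism -/

namespace BeadedDiagram

variable {X G : Type*} [AddCommMonoid G]

/-- The diagram `P` without beads. -/
def bare (P : PartitionDiagram X) : BeadedDiagram X G := ⟨P, fun _ => 0⟩

open scoped Classical in
/-- The diagram `P` with `s` beads on the block of `p` and no others. -/
noncomputable def single (P : PartitionDiagram X) (p : X ⊕ X) (s : G) : BeadedDiagram X G :=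
  ⟨P, fun b => if b = P.block p then s else 0⟩

theorem one_eq_bare : (1 : BeadedDiagram X G) = bare 1 := rfl

theorem single_zero (P : PartitionDiagram X) (p : X ⊕ X) :
    (single P p 0 : BeadedDiagram X G) = bare P :=
  ext' rfl fun v => by simp [single, bare]

theorem single_congr {P : PartitionDiagram X} {p q : X ⊕ X} (h : P.rel p q) (s : G) :
    single P p s = single P q s := by
  rw [single, single, block_eq.2 h]

theorem block_eq_iff_rel {P : PartitionDiagram X} {p v : X ⊕ X} :
    P.block v = P.block p ↔ P.rel p v := by
  rw [eq_comm, block_eq]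

variable [Finite X]

theorem bare_mul (P Q : PartitionDiagram X) :
    (bare P * bare Q : BeadedDiagram X G) = bare (P * Q) := by
  refine ext' rfl fun v => (mul_beads (bare P) (bare Q) ((P * Q).block v)).trans ?_
  exact (congrArg₂ (· + ·) (Finset.sum_eq_zero fun _ _ => ite_self _)
    (Finset.sum_eq_zero fun _ _ => ite_self _)).trans (add_zero _)

open scoped Classical in
/-- A line diagram with beads on the line through `x` only adds its beads to the block
of the upper point `x` of the factor below it. -/
theorem single_one_mul_beads (x : X) (s : G) (D : BeadedDiagram X G) (v : X ⊕ X) :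
    (single 1 (.inl x) s * D).beads ((1 * D.base).block v) =
      D.beads (D.base.block v) + if D.base.rel (.inl x) v then s else 0 := by
  have h : ∀ c : D.base.Block,
      lowerComponent 1 D.base c = outerComponent 1 D.base ((1 * D.base).block v) ↔
        c = D.base.block v := by
    intro c
    obtain ⟨w, rfl⟩ := block_surjective _ c
    rw [lower_outer, stack_one_left, block_eq]
    rcases v with v | v <;> rfl
  have h' : upperComponent 1 D.base ((1 : PartitionDiagram X).block (.inl x)) =
      outerComponent 1 D.base ((1 * D.base).block v) ↔ D.base.rel (.inl x) v := by
    rw [upper_outer, stack_one_left]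
    rcases v with v | v <;> rfl
  have := mul_beads (single 1 (.inl x) s) D ((1 * D.base).block v)
  rw [add_comm, this]
  congr 1
  · refine (Finset.sum_eq_single ((1 : PartitionDiagram X).block (.inl x)) ?_ ?_).trans ?_
    · intro b _ hb
      simp [single, hb]
    · exact fun h => absurd (Finset.mem_univ _) h
    · simp only [single, if_true]
      exact if_congr h' rfl rfl
  · refine (Finset.sum_congr rfl fun c _ => if_congr (h c) rfl rfl).trans ?_
    simp

open scoped Classical in
/-- A line diagram with beads on the line through `x` only adds its beads to the block
of the lower point `x` of the factor above it. -/
theorem mul_single_one_beads (x : X) (s : G) (D : BeadedDiagram X G) (v : X ⊕ X) :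
    (D * single 1 (.inl x) s).beads ((D.base * 1).block v) =
      D.beads (D.base.block v) + if D.base.rel (.inr x) v then s else 0 := by
  have h : ∀ c : D.base.Block,
      upperComponent D.base 1 c = outerComponent D.base 1 ((D.base * 1).block v) ↔
        c = D.base.block v := by
    intro c
    obtain ⟨w, rfl⟩ := block_surjective _ c
    rw [upper_outer, stack_one_right, block_eq]
    rcases v with v | v <;> rcases w with w | w <;> rfl
  have h' : lowerComponent D.base 1 ((1 : PartitionDiagram X).block (.inl x)) =
      outerComponent D.base 1 ((D.base * 1).block v) ↔ D.base.rel (.inr x) v := by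
    rw [lower_outer, stack_one_right]
    rcases v with v | v <;> rfl
  have := mul_beads D (single 1 (.inl x) s) ((D.base * 1).block v)
  rw [this]
  congr 1
  · refine (Finset.sum_congr rfl fun c _ => if_congr (h c) rfl rfl).trans ?_
    simp
  · refine (Finset.sum_eq_single ((1 : PartitionDiagram X).block (.inl x)) ?_ ?_).trans ?_
    · intro b _ hb
      simp [single, hb]
    · exact fun h => absurd (Finset.mem_univ _) h
    · simp only [single, if_true]
      exact if_congr h' rfl rfl

theorem single_one_mul_bare (x : X) (s : G) (P : PartitionDiagram X) :
    single 1 (.inl x) s * bare P = single P (.inl x) s := by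
  classical
  refine ext' (one_mul P) fun v => (single_one_mul_beads x s (bare P) v).trans ?_
  exact (zero_add _).trans (if_congr block_eq_iff_rel.symm rfl rfl)

theorem bare_mul_single_one (x : X) (s : G) (P : PartitionDiagram X) :
    bare P * single 1 (.inl x) s = single P (.inr x) s := by
  classical
  refine ext' (mul_one P) fun v => (mul_single_one_beads x s (bare P) v).trans ?_
  exact (zero_add _).trans (if_congr block_eq_iff_rel.symm rfl rfl)

/-- Beads on a component that does not reach an outer point are erased. -/
theorem single_mul_bare_of_inner {P Q : PartitionDiagram X} {p : X ⊕ X} (s : G)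
    (h : ∀ v, ¬ stack P Q (upper p) (outer v)) :
    single P p s * bare Q = bare (P * Q) := by
  classical
  refine ext' rfl fun v => ?_
  have := mul_beads (single P p s) (bare Q) ((P * Q).block v)
  refine this.trans ?_
  have h₁ : ∀ c : P.Block, (if upperComponent P Q c = outerComponent P Q ((P * Q).block v) then
      (single P p s).beads c else 0) = 0 := by
    intro c
    by_cases hc : c = P.block p
    · subst hc
      exact if_neg fun h' => h v (upper_outer.1 h')
    · simp [single, hc]
  exact (congrArg₂ (· + ·) (Finset.sum_eq_zero fun c _ => h₁ c)
    (Finset.sum_eq_zero fun _ _ => ite_self _)).trans (add_zero _)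

theorem single_one_mul_single_one (x y : X) (s t : G) :
    (single 1 (.inl x) s * single 1 (.inl y) t : BeadedDiagram X G) =
      single 1 (.inl y) t * single 1 (.inl x) s := by
  classical
  refine ext' rfl fun v => (single_one_mul_beads x s _ v).trans
    ((single_one_mul_beads y t _ v).trans ?_).symm
  simp only [single, block_eq_iff_rel]
  exact add_comm _ _

theorem single_one_pow (x : X) (s : G) (k : ℕ) :
    (single 1 (.inl x) s : BeadedDiagram X G) ^ k = single 1 (.inl x) (k • s) := by
  classical
  induction k with
  | zero => rw [pow_zero, zero_smul, single_zero, one_eq_bare]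
  | succ k ih =>
    rw [pow_succ, ih]
    refine ext' (mul_one _) fun v => (single_one_mul_beads x _ _ v).trans ?_
    simp only [single, block_eq_iff_rel]
    rw [succ_nsmul']
    by_cases h : (1 : PartitionDiagram X).rel (.inl x) v
    · exact (congrArg₂ (· + ·) (if_pos h) (if_pos h)).trans (if_pos h).symm
    · exact (congrArg₂ (· + ·) (if_neg h) (if_neg h)).trans ((add_zero _).trans (if_neg h).symm)

end BeadedDiagram

open BeadedDiagram

theorem AbacusHook.coe_u (d : ℕ) (i : Fin n) :
    (AbacusHook.u d i : BeadedDiagram (Fin (n + 1)) (ZMod d)) = bare (hookGen i) := rfl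

theorem AbacusHook.coe_z (d : ℕ) (j : Fin (n + 1)) :
    (AbacusHook.z d j : BeadedDiagram (Fin (n + 1)) (ZMod d)) = single 1 (.inl j) 1 := rfl

/-- The blocks `{i', i + 1'}` and `{i, i + 1}` of two stacked copies of `hookGen i` form a component
without outer points. -/
theorem hookGen_stack_inner {i : Fin n} (hi : i.val ≠ 0) (v : Fin (n + 1) ⊕ Fin (n + 1)) :
    ¬ stack (hookGen i) (hookGen i) (upper (.inr i.castSucc)) (outer v) := by
  classical
  intro h
  have hne : i.castSucc ≠ i.succ := (Fin.castSucc_lt_succ).ne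
  have := stack_ker (P := hookGen i) (Q := hookGen i)
    (Sum.elim (fun _ => False) (Sum.elim (fun k => k = i.castSucc ∨ k = i.succ) fun _ => False))
    (by
      intro v w hvw
      change hookLabel i v = hookLabel i w at hvw
      rcases v with v | v <;> rcases w with w | w <;>
        simp only [hookLabel, hi, if_false] at hvw <;>
        simp only [upper, Sum.elim_inl, Sum.elim_inr, Function.comp] <;> grind)
    (by
      intro v w hvw
      change hookLabel i v = hookLabel i w at hvw
      rcases v with v | v <;> rcases w with w | w <;>
        simp only [hookLabel, hi, if_false] at hvw <;>
        simp only [lower, Sum.elim_inl, Sum.elim_inr] <;> grind) h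
  rcases v with v | v <;> simp [upper, outer] at this

theorem abacus_relations (d n : ℕ) (a b : FreeMonoid (BlobGen n))
    (h : ConnectedFramedBlobRel d n a b) :
    FreeMonoid.lift (AbacusHook.gen d n) a = FreeMonoid.lift (AbacusHook.gen d n) b := by
  have hcomm : ∀ i j : Fin n, i.val + 1 < j.val ∨ j.val + 1 < i.val →
      hookGen i * hookGen j = hookGen j * hookGen i := by
    rintro i j (h | h)
    · exact hookGen_mul_comm i j h
    · exact (hookGen_mul_comm j i h).symm
  have hne : ∀ i : Fin n, i.castSucc ≠ i.succ := fun i => (Fin.castSucc_lt_succ).ne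
  cases h <;> apply Subtype.ext <;>
    simp only [BlobGen.U, BlobGen.Z, map_mul, map_pow, map_one, FreeMonoid.lift_eval_of,
      AbacusHook.gen, Submonoid.coe_mul, SubmonoidClass.coe_pow, Submonoid.coe_one,
      AbacusHook.coe_u, AbacusHook.coe_z, bare_mul, single_one_pow, single_one_mul_bare,
      bare_mul_single_one]
  case u_idem i => rw [hookGen_mul_self]
  case u_comm i j h => rw [hcomm i j h]
  case u_one_zero_one i j hi hj =>
    rw [hookGen_mul_jones i j (by omega) (by omega)]
  case u_jones i j hi hj h => rw [hookGen_mul_jones i j hi h]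
  case z_pow j =>
    rw [one_eq_bare, ← single_zero 1 (.inl j)]
    simp
  case z_comm j k => exact single_one_mul_single_one _ _ _ _
  case z_slide_left i =>
    refine single_congr ?_ _
    simp [hookGen_rel, hookLabel]
  case z_slide_right i =>
    refine single_congr ?_ _
    simp [hookGen_rel, hookLabel]
  case u_z_comm i j h h' =>
    refine single_congr ?_ _
    simp [hookGen_rel, hookLabel, h, h']
  case z_zero_u_zero i hi =>
    refine single_congr ?_ _
    have : (0 : Fin (n + 1)) = i.castSucc := by simp [Fin.ext_iff, hi]
    have := hne i
    simp only [hookGen_rel, hookLabel]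
    grind
  case u_loop i hi k =>
    rw [single_mul_bare_of_inner _ (hookGen_stack_inner hi), hookGen_mul_self]

/-- The homomorphism from the connected framed blob monoid to the abacus hook monoid. -/
noncomputable def abacusHom (d n : ℕ) : ConnectedFramedBlob d n →* AbacusHook d n :=
  PresentedMonoid.lift (AbacusHook.gen d n) (abacus_relations d n)

/-! ### Words in the blob generators -/

/-- The relations of the blob monoid with generators `v 0, …, v (n - 1)`; the values of `v`
beyond `n` play no role. -/
structure IsBlobFamily {N : Type*} [Monoid N] (n : ℕ) (v : ℕ → N) : Prop where
  idem : ∀ i < n, v i * v i = v i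
  comm : ∀ i j, i + 1 < j → j < n → v i * v j = v j * v i
  jones_up : ∀ i, i + 1 < n → v (i + 1) * v i * v (i + 1) = v (i + 1)
  jones_down : ∀ i, i ≠ 0 → i + 1 < n → v i * v (i + 1) * v i = v i

namespace IsBlobFamily

variable {N : Type*} [Monoid N] {n : ℕ} {v : ℕ → N}

/-- The submonoid generated by `v 0, …, v (m - 1)`. -/
def genBelow (v : ℕ → N) (m : ℕ) : Submonoid N := Submonoid.closure (v '' Set.Iio m)

theorem mem_genBelow {m i : ℕ} (h : i < m) : v i ∈ genBelow v m :=
  Submonoid.subset_closure ⟨i, h, rfl⟩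

theorem genBelow_mono {m m' : ℕ} (h : m ≤ m') : genBelow v m ≤ genBelow v m' :=
  Submonoid.closure_mono (Set.image_mono (Set.Iio_subset_Iio h))

theorem genBelow_induction {m : ℕ} {p : N → Prop} (one : p 1)
    (mul : ∀ i < m, ∀ x ∈ genBelow v m, p x → p (v i * x)) {x : N} (hx : x ∈ genBelow v m) :
    p x := by
  refine Submonoid.closure_induction_left (motive := fun x _ => p x) one ?_ hx
  rintro _ ⟨i, hi, rfl⟩ y hy h
  exact mul i hi y hy h

/-- `Run v m k x` says that `x` has the form `v k * v (k + 1) * ⋯ * v (m - 1) * b`, where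
`b` is a product of generators below `v (m - 1)`. -/
inductive Run (v : ℕ → N) (m : ℕ) : ℕ → N → Prop
  | base {b : N} (h : b ∈ genBelow v (m - 1)) : Run v m m b
  | step {k : ℕ} {x : N} (hk : k < m) (h : Run v m (k + 1) x) : Run v m k (v k * x)

theorem Run.le {m k : ℕ} {x : N} (h : Run v m k x) : k ≤ m := by
  cases h with
  | base => exact le_rfl
  | step hk _ => exact hk.le

theorem Run.exists_eq {m k : ℕ} {x : N} (h : Run v m k x) (hk : k < m) :
    ∃ y, Run v m (k + 1) y ∧ x = v k * y := by
  cases h with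
  | base => exact absurd hk (lt_irrefl _)
  | step _ h => exact ⟨_, h, rfl⟩

theorem Run.mem_of_eq {m : ℕ} {x : N} (h : Run v m m x) : x ∈ genBelow v (m - 1) := by
  generalize hk : m = k at h
  cases h with
  | base h => subst hk; exact h
  | step h' _ => omega

theorem Run.mem {m k : ℕ} {x : N} (h : Run v m k x) : x ∈ genBelow v m := by
  induction h with
  | base h => exact genBelow_mono (Nat.sub_le _ _) h
  | step hk _ ih => exact mul_mem (mem_genBelow hk) ih

/-- Generators far below the run can be moved into the last factor. -/
theorem run_mul_of_lt (hv : IsBlobFamily n v) {m k i : ℕ} {x : N} (hm : m ≤ n)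
    (h : Run v m k x) (hi : i + 1 < k) :
    Run v m k (v i * x) := by
  induction h with
  | base h => exact .base (mul_mem (mem_genBelow (by omega)) h)
  | @step k x hk _ ih =>
    rw [← mul_assoc, hv.comm i k hi (by omega), mul_assoc]
    exact .step hk (ih (by omega))

/-- A generator that occurs in the initial part of a run, but not as one of its first two letters,
can be moved to the front, where it starts a shorter run. -/
theorem run_mul_of_gt (hv : IsBlobFamily n v) {m k i : ℕ} {x : N} (hm : m ≤ n)
    (h : Run v m k x) (hi : k + 2 ≤ i) (him : i < m) : Run v m i (v i * x) := by
  induction h with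
  | base h => omega
  | @step k x hk h ih =>
    rw [← mul_assoc, ← hv.comm k i (by omega) (by omega), mul_assoc]
    refine hv.run_mul_of_lt hm ?_ (by omega)
    rcases hi.eq_or_lt with rfl | hi
    · obtain ⟨y, hy, rfl⟩ := h.exists_eq (by omega)
      obtain ⟨z, hz, rfl⟩ := hy.exists_eq (by omega)
      rw [← mul_assoc, ← mul_assoc, hv.jones_up (k + 1) (by omega)]
      exact hy
    · exact ih (by omega)

theorem exists_run_mul (hv : IsBlobFamily n v) {m k i : ℕ} {x : N} (hm : m ≤ n)
    (h : Run v m k x) (hi : i < m) :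
    ∃ k, Run v m k (v i * x) := by
  rcases lt_trichotomy (i + 1) k with hk | rfl | hk
  · exact ⟨_, hv.run_mul_of_lt hm h hk⟩
  · exact ⟨_, .step hi h⟩
  · rcases (by omega : i = k ∨ i = k + 1 ∨ k + 2 ≤ i) with rfl | rfl | hk
    · obtain ⟨y, hy, rfl⟩ := h.exists_eq hi
      rw [← mul_assoc, hv.idem i (by omega)]
      exact ⟨_, h⟩
    · obtain ⟨y, hy, rfl⟩ := h.exists_eq (by omega)
      obtain ⟨z, hz, rfl⟩ := hy.exists_eq (by omega)
      rw [← mul_assoc, ← mul_assoc, hv.jones_up k (by omega)]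
      exact ⟨_, hy⟩
    · exact ⟨_, hv.run_mul_of_gt hm h hk hi⟩

/-- Every product of generators below `v m` is a run followed by a product of generators
below `v (m - 1)`. -/
theorem exists_run (hv : IsBlobFamily n v) {m : ℕ} {x : N} (hm : m ≤ n)
    (hx : x ∈ genBelow v m) : ∃ k, Run v m k x := by
  refine genBelow_induction (p := fun x => ∃ k, Run v m k x) ⟨m, .base (one_mem _)⟩ ?_ hx
  rintro i hi x - ⟨k, h⟩
  exact hv.exists_run_mul hm h hi

/-- After multiplication by `v m` from above, a product of `v 0, …, v m` may be replaced by one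
without the letter `v m`. -/
theorem exists_mul_eq (hv : IsBlobFamily n v) {m : ℕ} {x : N} (hm : m + 1 ≤ n)
    (hx : x ∈ genBelow v (m + 1)) :
    ∃ b ∈ genBelow v m, v m * x = v m * b := by
  have key : ∀ {z}, Run v (m + 1) m z → ∃ b ∈ genBelow v m, z = v m * b := by
    intro z hz
    obtain ⟨y, hy, rfl⟩ := hz.exists_eq (by omega)
    exact ⟨y, hy.mem_of_eq, rfl⟩
  obtain ⟨k, h⟩ := hv.exists_run hm hx
  have hk := h.le
  rcases (by omega : k = m + 1 ∨ k = m ∨ m = k + 1 ∨ k + 2 ≤ m) with rfl | rfl | rfl | hk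
  · exact ⟨x, h.mem_of_eq, rfl⟩
  · obtain ⟨y, hy, rfl⟩ := h.exists_eq (by omega)
    rw [← mul_assoc, hv.idem k (by omega)]
    exact key h
  · obtain ⟨y, hy, rfl⟩ := h.exists_eq (by omega)
    obtain ⟨z, hz, rfl⟩ := hy.exists_eq (by omega)
    rw [← mul_assoc, ← mul_assoc, hv.jones_up k (by omega)]
    exact key hy
  · exact key (hv.run_mul_of_gt hm h hk (by omega))

end IsBlobFamily

/-! ### Arcs of a diagram and letters of a word -/

/-- The upper points `a` and `b` of a diagram lie in the same block. -/
def topRel {n : ℕ} (D : PartitionDiagram (Fin (n + 1))) (a b : ℕ) : Prop :=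
  ∃ (ha : a < n + 1) (hb : b < n + 1), D.rel (.inl ⟨a, ha⟩) (.inl ⟨b, hb⟩)

namespace topRel

variable {n : ℕ} {D : PartitionDiagram (Fin (n + 1))} {a b c : ℕ}

theorem symm (h : topRel D a b) : topRel D b a :=
  ⟨h.2.1, h.1, Setoid.symm' _ h.2.2⟩

theorem trans (h : topRel D a b) (h' : topRel D b c) : topRel D a c :=
  ⟨h.1, h'.2.1, Setoid.trans' _ h.2.2 h'.2.2⟩

theorem refl (h : a < n + 1) : topRel D a a := ⟨h, h, Setoid.refl' _ _⟩

end topRel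

/-- A family that satisfies the blob relations and is mapped to the generators of the hook blob
monoid. -/
structure IsHookFamily {M : Type*} [Monoid M] (n : ℕ) (v : ℕ → M)
    (π : M →* PartitionDiagram (Fin (n + 1))) : Prop extends IsBlobFamily n v where
  map : ∀ i (h : i < n), π (v i) = hookGen ⟨i, h⟩

namespace IsHookFamily

open IsBlobFamily

variable {M : Type*} [Monoid M] {n : ℕ} {v : ℕ → M} {π : M →* PartitionDiagram (Fin (n + 1))}

theorem isHookEnd_inl {i a : ℕ} (hi : i < n) (ha : a < n + 1) :
    IsHookEnd (n := n) ⟨i, hi⟩ (.inl ⟨a, ha⟩) ↔ a = i ∨ a = i + 1 := by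
  simp [IsHookEnd, Fin.ext_iff]

theorem map_mul (hv : IsHookFamily n v π) {k : ℕ} (hk : k < n) (x : M) :
    π (v k * x) = hookGen ⟨k, hk⟩ * π x := by
  rw [_root_.map_mul, hv.map k hk]

theorem topRel_self_succ (hv : IsHookFamily n v π) {k : ℕ} (hk : k < n) (x : M) :
    topRel (π (v k * x)) k (k + 1) := by
  refine ⟨by omega, by omega, ?_⟩
  rw [hv.map_mul hk]
  by_cases h : k = 0
  · exact (hookGen_zero_mul_rel (i := ⟨k, hk⟩) h).2
      (.inr (.inl ⟨Setoid.refl' _ _, Setoid.refl' _ _⟩))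
  · exact (hookGen_mul_rel (i := ⟨k, hk⟩) h).2
      (.inl ⟨(isHookEnd_inl _ _).2 (.inl rfl), (isHookEnd_inl _ _).2 (.inr rfl)⟩)

/-- In the diagram of `v k * x`, `k ≠ 0`, the upper points `k` and `k + 1` are connected to no other
upper points. -/
theorem eq_of_topRel (hv : IsHookFamily n v π) {k a b : ℕ} (hk : k < n) {x : M} (h₀ : k ≠ 0)
    (ha : a = k ∨ a = k + 1) (h : topRel (π (v k * x)) a b) : b = k ∨ b = k + 1 := by
  obtain ⟨ha', hb', h⟩ := h
  rw [hv.map_mul hk] at h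
  rcases (hookGen_mul_rel (i := ⟨k, hk⟩) h₀).1 h with ⟨-, h⟩ | ⟨h, -⟩
  · exact (isHookEnd_inl _ _).1 h
  · exact absurd ((isHookEnd_inl _ _).2 ha) h

/-- Multiplication by `v k` connects further upper points only through the pair `k, k + 1`. -/
theorem link_of_topRel (hv : IsHookFamily n v π) {k a b : ℕ} (hk : k < n) {x : M}
    (ha : k = 0 ∨ (a ≠ k ∧ a ≠ k + 1)) (h : topRel (π (v k * x)) a b) :
    topRel (π x) a b ∨ (topRel (π x) a k ∧ topRel (π x) (k + 1) b) ∨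
      (topRel (π x) a (k + 1) ∧ topRel (π x) k b) := by
  obtain ⟨ha', hb', h⟩ := h
  rw [hv.map_mul hk] at h
  have key : (π x).link (.inl (Fin.castSucc ⟨k, hk⟩)) (.inl (Fin.succ ⟨k, hk⟩))
      (.inl ⟨a, ha'⟩) (.inl ⟨b, hb'⟩) := by
    by_cases h₀ : k = 0
    · exact (hookGen_zero_mul_rel (i := ⟨k, hk⟩) h₀).1 h
    · rcases (hookGen_mul_rel (i := ⟨k, hk⟩) h₀).1 h with ⟨h, -⟩ | ⟨-, -, h⟩
      · have := (isHookEnd_inl _ _).1 h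
        omega
      · exact h
  rcases key with h | ⟨h, h'⟩ | ⟨h, h'⟩
  · exact .inl ⟨_, _, h⟩
  · exact .inr (.inl ⟨⟨_, _, h⟩, ⟨_, _, h'⟩⟩)
  · exact .inr (.inr ⟨⟨_, _, h⟩, ⟨_, _, h'⟩⟩)

theorem topRel_of_link (hv : IsHookFamily n v π) {k a b : ℕ} (hk : k < n) {x : M}
    (ha : k = 0 ∨ (a ≠ k ∧ a ≠ k + 1 ∧ b ≠ k ∧ b ≠ k + 1))
    (h : topRel (π x) a b ∨ (topRel (π x) a k ∧ topRel (π x) (k + 1) b) ∨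
      (topRel (π x) a (k + 1) ∧ topRel (π x) k b)) : topRel (π (v k * x)) a b := by
  have key : ∃ (ha' : a < n + 1) (hb' : b < n + 1),
      (π x).link (.inl (Fin.castSucc ⟨k, hk⟩)) (.inl (Fin.succ ⟨k, hk⟩))
        (.inl ⟨a, ha'⟩) (.inl ⟨b, hb'⟩) := by
    rcases h with ⟨_, _, h⟩ | ⟨⟨_, _, h⟩, ⟨_, _, h'⟩⟩ | ⟨⟨_, _, h⟩, ⟨_, _, h'⟩⟩
    · exact ⟨_, _, .inl h⟩
    · exact ⟨_, _, .inr (.inl ⟨h, h'⟩)⟩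
    · exact ⟨_, _, .inr (.inr ⟨h, h'⟩)⟩
  obtain ⟨ha', hb', key⟩ := key
  refine ⟨ha', hb', ?_⟩
  rw [hv.map_mul hk]
  by_cases h₀ : k = 0
  · exact (hookGen_zero_mul_rel (i := ⟨k, hk⟩) h₀).2 key
  · refine (hookGen_mul_rel (i := ⟨k, hk⟩) h₀).2 (.inr ⟨?_, ?_, key⟩)
    · rw [isHookEnd_inl]; omega
    · rw [isHookEnd_inl]; omega

/-- Products of generators below `v m` do not touch the lines to the right of `m`. -/
theorem rel_line_iff (hv : IsHookFamily n v π) {m : ℕ} {x : M}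
    (hx : x ∈ genBelow v m) {k : Fin (n + 1)} (hk : m < k.val) :
    ∀ w, (π x).rel (.inl k) w ↔ w = .inl k ∨ w = .inr k := by
  refine genBelow_induction (p := fun x =>
    ∀ w, (π x).rel (.inl k) w ↔ w = .inl k ∨ w = .inr k) ?_ ?_ hx
  · intro w
    rw [map_one, one_rel]
    rcases w with w | w <;> simp [eq_comm]
  · intro i hi x _ ih w
    have hi' : i < n := by omega
    have h₁ : ∀ {w}, (π x).rel w (.inl k) ↔ w = .inl k ∨ w = .inr k :=
      (⟨fun h => Setoid.symm' _ h, fun h => Setoid.symm' _ h⟩ : _ ↔ _).trans (ih _)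
    have h₂ : ∀ {w}, (π x).rel w (.inr k) ↔ w = .inl k ∨ w = .inr k := by
      intro w
      have h : (π x).rel (.inl k) (.inr k) := (ih _).2 (.inr rfl)
      rw [← h₁]
      exact ⟨fun h' => Setoid.trans' _ h' (Setoid.symm' _ h), fun h' => Setoid.trans' _ h' h⟩
    have hend : ¬ IsHookEnd (n := n) ⟨i, hi'⟩ (.inl k) := by
      rw [show k = ⟨k.val, k.isLt⟩ from rfl, isHookEnd_inl]; omega
    have h₃ : ¬ (π x).rel (.inl k) (.inl (Fin.castSucc ⟨i, hi'⟩)) := by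
      rw [ih]; simp [Fin.ext_iff]; omega
    have h₄ : ¬ (π x).rel (.inl k) (.inl (Fin.succ ⟨i, hi'⟩)) := by
      rw [ih]; simp [Fin.ext_iff]; omega
    rw [hv.map_mul hi']
    by_cases h₀ : i = 0
    · rw [hookGen_zero_mul_rel (i := ⟨i, hi'⟩) h₀, link_rel, ih]
      simp only [h₃, h₄, false_and, or_false]
    · rw [hookGen_mul_rel (i := ⟨i, hi'⟩) h₀, link_rel, ih]
      simp only [h₃, h₄, hend, false_and, or_false, not_false_eq_true, true_and, false_or]
      refine ⟨fun h => h.2, fun h => ⟨?_, h⟩⟩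
      rcases h with rfl | rfl
      · exact hend
      · simp [IsHookEnd]

theorem eq_of_topRel_line (hv : IsHookFamily n v π) {m : ℕ} {x : M}
    (hx : x ∈ genBelow v m) {k b : ℕ} (hk : m < k) (h : topRel (π x) k b) : b = k := by
  obtain ⟨hk', hb, h⟩ := h
  rcases (hv.rel_line_iff hx (k := ⟨k, hk'⟩) hk _).1 h with h | h
  · simpa [Fin.ext_iff] using h
  · cases h

/-- The upper point `k` of a run that starts with `v k`, or with no generator at all, is at most
connected to the upper point `k + 1`. -/
theorem eq_of_topRel_run (hv : IsHookFamily n v π) {m k b : ℕ} (hm : m ≤ n) {x : M} (h₀ : k ≠ 0)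
    (hx : Run v m k x) (h : topRel (π x) k b) : b = k ∨ b = k + 1 := by
  rcases hx.le.eq_or_lt with rfl | hk
  · exact .inl (hv.eq_of_topRel_line (m := k - 1) hx.mem_of_eq (by omega) h)
  · obtain ⟨y, -, rfl⟩ := hx.exists_eq hk
    exact hv.eq_of_topRel (by omega) h₀ (.inl rfl) h

theorem le_of_topRel (hv : IsHookFamily n v π) {m a b : ℕ} {x : M}
    (hx : x ∈ genBelow v m) (h : topRel (π x) a b) (hab : a ≠ b) : a ≤ m := by
  by_contra hlt
  exact hab (hv.eq_of_topRel_line hx (by omega) h).symm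

/-- If the diagram of `x` has an upper arc `{i, i + 1}` that is not connected to `0`, then `x`
absorbs `v i`. -/
theorem mul_eq_of_hook (hv : IsHookFamily n v π) : ∀ {m : ℕ}, m ≤ n → ∀ {x : M},
    x ∈ genBelow v m → ∀ {i : ℕ}, i ≠ 0 → topRel (π x) i (i + 1) → ¬ topRel (π x) i 0 →
      v i * x = x := by
  intro m
  induction m with
  | zero =>
    intro hm x hx i hi h _
    have := hv.le_of_topRel hx h (by omega)
    omega
  | succ m IH =>
    intro hm
    -- `t` is the number of letters of the run in front of the last factor.
    have key : ∀ t k x, m + 1 - k = t → Run v (m + 1) k x → ∀ i, i ≠ 0 →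
        topRel (π x) i (i + 1) → ¬ topRel (π x) i 0 → v i * x = x := by
      intro t
      induction t using Nat.strong_induction_on with
      | _ t ih =>
      intro k x ht hx i hi h h₀
      have him := hv.le_of_topRel hx.mem h.symm (by omega)
      rcases hx.le.eq_or_lt with rfl | hk
      · exact IH (by omega) hx.mem_of_eq hi h h₀
      obtain ⟨y, hy, rfl⟩ := hx.exists_eq hk
      have hkn : k < n := by omega
      have hexcl : ∀ {b}, topRel (π y) (k + 1) b → b = k + 1 ∨ b = k + 2 := fun h =>
        hv.eq_of_topRel_run hm (by omega) hy h
      rcases (by omega : i = k ∨ i = k + 1 ∨ i + 1 = k ∨ i = k + 2 ∨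
        (i + 1 < k ∨ k + 2 < i)) with rfl | rfl | rfl | rfl | hik
      · rw [← mul_assoc, hv.idem _ hkn]
      · by_cases hk0 : k = 0
        · subst hk0
          exact absurd (hv.topRel_self_succ hkn y).symm h₀
        · have := hv.eq_of_topRel hkn hk0 (.inr rfl) h
          omega
      · have := hv.eq_of_topRel hkn (by omega) (.inl rfl) h.symm
        omega
      · -- The arc `{k + 2, k + 3}` arises from arcs `{k + 1, k + 2}` and `{k, k + 3}` of `y`.
        obtain ⟨z, hz, rfl⟩ := hy.exists_eq (by omega)
        obtain ⟨w, hw, rfl⟩ := hz.exists_eq (by omega)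
        have hlink := hv.link_of_topRel hkn (by omega) h
        have h₁ : topRel (π (v (k + 1) * (v (k + 1 + 1) * w))) k (k + 3) := by
          rcases hlink with h | ⟨h, h'⟩ | ⟨h, h'⟩
          · have := hv.eq_of_topRel (by omega) (by omega) (.inr rfl) h
            omega
          · have := hexcl h'
            omega
          · exact h'
        have hk0 : k ≠ 0 := by
          rintro rfl
          exact h₀ (h.trans (hv.topRel_of_link hkn (.inl rfl) (.inl h₁)).symm)
        have h₂ : topRel (π (v (k + 1 + 1) * w)) k (k + 1) := by
          rcases hv.link_of_topRel (by omega) (by omega) h₁ with h | ⟨h, h'⟩ | ⟨h, h'⟩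
          · have := hv.eq_of_topRel (by omega) (by omega) (.inr rfl) h.symm
            omega
          · exact h
          · have := hv.eq_of_topRel (by omega) (by omega) (.inl rfl) h.symm
            omega
        have h₃ : ¬ topRel (π (v (k + 1 + 1) * w)) k 0 := by
          intro h'
          have h₄ := hv.topRel_of_link (k := k + 1) (by omega) (by omega) (.inl h')
          exact h₀ (h.trans (hv.topRel_of_link hkn (by omega) (.inl (h₁.symm.trans h₄))))
        have h₅ := ih _ (by omega) _ _ rfl hz k hk0 h₂ h₃
        have h₆ : v k * (v (k + 1) * (v (k + 1 + 1) * w)) = v (k + 1 + 1) * w := by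
          conv_lhs => rw [← h₅]
          rw [← mul_assoc, ← mul_assoc, hv.jones_down k hk0 (by omega), h₅]
        rw [h₆, ← mul_assoc, hv.idem _ (by omega)]
      · have hd : topRel (π y) i (i + 1) := by
          rcases hv.link_of_topRel hkn (by omega) h with h | ⟨h, h'⟩ | ⟨h, h'⟩
          · exact h
          · have := hexcl h'
            omega
          · have := hexcl h.symm
            omega
        have hd₀ : ¬ topRel (π y) i 0 := fun h' =>
          h₀ (hv.topRel_of_link hkn (by omega) (.inl h'))
        have hiy := ih _ (by omega) _ _ rfl hy i hi hd hd₀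
        have hc : v i * v k = v k * v i := by
          rcases hik with hik | hik
          · exact hv.comm i k hik hkn
          · exact (hv.comm k i (by omega) (by omega)).symm
        rw [← mul_assoc, hc, mul_assoc, hiy]
    intro x hx i
    obtain ⟨k, hk⟩ := hv.exists_run hm hx
    exact key _ k x rfl hk i

/-- If `0` and `1` are connected in the diagram of `x`, then `x` absorbs `v 0`. -/
theorem mul_eq_of_zero_one (hv : IsHookFamily n v π) : ∀ {m : ℕ}, m ≤ n → ∀ {x : M},
    x ∈ genBelow v m → topRel (π x) 1 0 → v 0 * x = x := by
  intro m
  induction m with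
  | zero =>
    intro hm x hx h
    have := hv.le_of_topRel hx h (by omega)
    omega
  | succ m IH =>
    intro hm x hx h
    obtain ⟨k, hk⟩ := hv.exists_run hm hx
    clear hx
    induction hk with
    | base hx => exact IH (by omega) hx h
    | @step k y hk hy ih =>
      have hkn : k < n := by omega
      rcases (by omega : k = 0 ∨ k = 1 ∨ 1 < k) with rfl | rfl | hk1
      · rw [← mul_assoc, hv.idem _ hkn]
      · have := hv.eq_of_topRel hkn (by omega) (.inl rfl) h
        omega
      · have hd : topRel (π y) 1 0 := by
          rcases hv.link_of_topRel hkn (by omega) h with h | ⟨h, h'⟩ | ⟨h, h'⟩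
          · exact h
          · have := hv.eq_of_topRel_run hm (by omega) hy h'
            omega
          · have := hv.eq_of_topRel_run hm (by omega) hy h.symm
            omega
        rw [← mul_assoc, hv.comm 0 k hk1 hkn, mul_assoc, ih hd]

/-- If `0` and `2` are connected in the diagram of `x`, then `x` absorbs `v 0 * v 1`. -/
theorem mul_eq_of_zero_two (hv : IsHookFamily n v π) : ∀ {m : ℕ}, m ≤ n → ∀ {x : M},
    x ∈ genBelow v m → topRel (π x) 2 0 → v 0 * (v 1 * x) = x := by
  intro m
  induction m with
  | zero =>
    intro hm x hx h
    have := hv.le_of_topRel hx h (by omega)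
    omega
  | succ m IH =>
    intro hm x hx h
    have hm2 := hv.le_of_topRel hx h (by omega)
    obtain ⟨k, hk⟩ := hv.exists_run hm hx
    clear hx
    induction hk with
    | base hx => exact IH (by omega) hx h
    | @step k y hk hy ih =>
      have hkn : k < n := by omega
      rcases (by omega : k = 0 ∨ (k = 1 ∨ k = 2) ∨ 2 < k) with rfl | hk12 | hk2
      · obtain ⟨z, hz, rfl⟩ := hy.exists_eq (by omega)
        have := hv.jones_up 0 (by omega)
        rw [zero_add] at this ⊢
        conv_rhs => rw [← this]
        simp only [mul_assoc]
      · have := hv.eq_of_topRel hkn (by omega) (by omega) h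
        omega
      · have hd : topRel (π y) 2 0 := by
          rcases hv.link_of_topRel hkn (by omega) h with h | ⟨h, h'⟩ | ⟨h, h'⟩
          · exact h
          · have := hv.eq_of_topRel_run hm (by omega) hy h'
            omega
          · have := hv.eq_of_topRel_run hm (by omega) hy h.symm
            omega
        rw [← mul_assoc (v 1), hv.comm 1 k hk2 hkn, mul_assoc, ← mul_assoc (v 0),
          hv.comm 0 k (by omega) hkn, mul_assoc, ih hd]

end IsHookFamily

/-! ### Words are determined by their diagrams -/

open IsBlobFamily

namespace IsHookFamily

variable {M : Type*} [Monoid M] {n : ℕ} {v : ℕ → M} {π : M →* PartitionDiagram (Fin (n + 1))}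

/-- Products of generators below `v m` agree on the line through the point `k > m`. -/
theorem rel_eq_of_line (hv : IsHookFamily n v π) {m : ℕ} {b b' : M} (hb : b ∈ genBelow v m)
    (hb' : b' ∈ genBelow v m) {k : Fin (n + 1)} (hk : m < k.val) {x : Fin (n + 1) ⊕ Fin (n + 1)}
    (hx : ¬ (x ≠ .inl k ∧ x ≠ .inr k)) (y : Fin (n + 1) ⊕ Fin (n + 1)) :
    (π b).rel x y ↔ (π b').rel x y := by
  have hline := hv.rel_line_iff hb hk
  have hline' := hv.rel_line_iff hb' hk
  have hr : ∀ {b}, (π b).rel (.inl k) (.inr k) →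
      ((π b).rel (.inr k) y ↔ (π b).rel (.inl k) y) := fun h =>
    ⟨fun h' => Setoid.trans' _ h h', fun h' => Setoid.trans' _ (Setoid.symm' _ h) h'⟩
  obtain rfl | rfl : x = .inl k ∨ x = .inr k := by tauto
  · rw [hline, hline']
  · rw [hr ((hline _).2 (.inr rfl)), hr ((hline' _).2 (.inr rfl)), hline, hline']

/-- For a product `b` of generators below `v m`, `m ≠ 0`, multiplication by `v m` just bends the
upper end point `m` of the diagram of `b` around to the lower point `m + 1`. -/
theorem rel_bend (hv : IsHookFamily n v π) {m : ℕ} (hm : m < n) (h₀ : m ≠ 0) {b : M}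
    (hb : b ∈ genBelow v m) {x y : Fin (n + 1) ⊕ Fin (n + 1)}
    (hx : x ≠ .inl (Fin.succ ⟨m, hm⟩) ∧ x ≠ .inr (Fin.succ ⟨m, hm⟩))
    (hy : y ≠ .inl (Fin.succ ⟨m, hm⟩) ∧ y ≠ .inr (Fin.succ ⟨m, hm⟩)) :
    (π b).rel x y ↔ (π (v m * b)).rel
      (if x = .inl (Fin.castSucc ⟨m, hm⟩) then .inr (Fin.succ ⟨m, hm⟩) else x)
      (if y = .inl (Fin.castSucc ⟨m, hm⟩) then .inr (Fin.succ ⟨m, hm⟩) else y) := by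
  have hline := hv.rel_line_iff hb (k := Fin.succ ⟨m, hm⟩) (by simp)
  have hline' : ∀ w, (π b).rel (.inr (Fin.succ ⟨m, hm⟩)) w ↔
      w = .inl (Fin.succ ⟨m, hm⟩) ∨ w = .inr (Fin.succ ⟨m, hm⟩) := by
    intro w
    have h := (hline _).2 (.inr rfl)
    rw [← hline]
    exact ⟨fun h' => Setoid.trans' _ h h', fun h' => Setoid.trans' _ (Setoid.symm' _ h) h'⟩
  have hcomm : ∀ {x y}, (π b).rel x y ↔ (π b).rel y x :=
    ⟨fun h => Setoid.symm' _ h, fun h => Setoid.symm' _ h⟩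
  have hrefl : ∀ x, (π b).rel x x := fun x => Setoid.refl' _ x
  have hne : Fin.castSucc ⟨m, hm⟩ ≠ Fin.succ (⟨m, hm⟩ : Fin n) := (Fin.castSucc_lt_succ).ne
  rw [hv.map_mul hm, hookGen_mul_rel (i := ⟨m, hm⟩) h₀, link_rel]
  simp only [IsHookEnd]
  generalize Fin.castSucc (⟨m, hm⟩ : Fin n) = p at *
  generalize Fin.succ (⟨m, hm⟩ : Fin n) = q at *
  by_cases hxp : x = .inl p <;> by_cases hyp : y = .inl p <;>
    simp [hline, hline', hxp, hyp, hx, hy] <;> grind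

/-- Multiplication by `v m` is injective on diagrams of products of generators below `v m`. -/
theorem map_eq_of_map_mul_eq (hv : IsHookFamily n v π) {m : ℕ} (hm : m < n) (h₀ : m ≠ 0)
    {b b' : M} (hb : b ∈ genBelow v m) (hb' : b' ∈ genBelow v m)
    (h : π (v m * b) = π (v m * b')) : π b = π b' := by
  ext x y
  by_cases hx : x ≠ .inl (Fin.succ ⟨m, hm⟩) ∧ x ≠ .inr (Fin.succ ⟨m, hm⟩)
  · by_cases hy : y ≠ .inl (Fin.succ ⟨m, hm⟩) ∧ y ≠ .inr (Fin.succ ⟨m, hm⟩)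
    · rw [hv.rel_bend hm h₀ hb hx hy, hv.rel_bend hm h₀ hb' hx hy, h]
    · exact (⟨fun h => Setoid.symm' _ h, fun h => Setoid.symm' _ h⟩ : _ ↔ _).trans
        ((hv.rel_eq_of_line hb hb' (by simp) hy x).trans
          ⟨fun h => Setoid.symm' _ h, fun h => Setoid.symm' _ h⟩)
  · exact hv.rel_eq_of_line hb hb' (by simp) hx y

/-- Products of the generators are determined by their diagrams. -/
theorem eq_of_map_eq (hv : IsHookFamily n v π) : ∀ {m : ℕ}, m ≤ n → ∀ {x x' : M},
    x ∈ genBelow v m → x' ∈ genBelow v m → π x = π x' → x = x' := by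
  intro m
  induction m with
  | zero =>
    intro _ x x' hx hx' _
    have h : ∀ {x : M}, x ∈ genBelow v 0 → x = 1 := by
      intro x hx
      simpa [genBelow] using hx
    rw [h hx, h hx']
  | succ m IH =>
    intro hm
    have hmn : m < n := by omega
    -- Elements that absorb the same `v k` can be compared after multiplication by
    -- `v m * ⋯ * v (k + 1)`, which moves their common arc to `{m, m + 1}`.
    have hook : ∀ t k, m - k = t → k ≤ m → ∀ x ∈ genBelow v (m + 1), ∀ x' ∈ genBelow v (m + 1),
        v k * x = x → v k * x' = x' → (k < m → v k * (v (k + 1) * x) = x) →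
        (k < m → v k * (v (k + 1) * x') = x') → π x = π x' → x = x' := by
      intro t
      induction t with
      | zero =>
        intro k ht hk x hx x' hx' h h' _ _ hπ
        obtain rfl : k = m := by omega
        obtain ⟨b, hb, hxb⟩ := hv.exists_mul_eq hm hx
        obtain ⟨b', hb', hxb'⟩ := hv.exists_mul_eq hm hx'
        rw [← h, ← h', hxb, hxb'] at hπ ⊢
        by_cases h₀ : k = 0
        · subst h₀
          have h : ∀ {x : M}, x ∈ genBelow v 0 → x = 1 := by
            intro x hx
            simpa [genBelow] using hx
          rw [h hb, h hb']
        · rw [IH hmn.le hb hb' (hv.map_eq_of_map_mul_eq hmn h₀ hb hb' hπ)]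
      | succ t ih =>
        intro k ht hk x hx x' hx' _ _ h h' hπ
        have hmem : v (k + 1) ∈ genBelow v (m + 1) := mem_genBelow (by omega)
        have hidem : ∀ y, v (k + 1) * (v (k + 1) * y) = v (k + 1) * y := fun y => by
          rw [← mul_assoc, hv.idem _ (by omega)]
        have hback : ∀ y, k + 1 < m →
            v (k + 1) * (v (k + 1 + 1) * (v (k + 1) * y)) = v (k + 1) * y := fun y _ => by
          rw [← mul_assoc, ← mul_assoc, hv.jones_down (k + 1) (by omega) (by omega)]
        have := ih (k + 1) (by omega) (by omega) _ (mul_mem hmem hx) _ (mul_mem hmem hx')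
          (hidem x) (hidem x') (hback x) (hback x') (by rw [_root_.map_mul, hπ, _root_.map_mul])
        rw [← h (by omega), this, h' (by omega)]
    have main : ∀ {k x x'}, Run v (m + 1) k x → k < m + 1 → x' ∈ genBelow v (m + 1) →
        π x = π x' → x = x' := by
      intro k x x' hx hk hx' hπ
      have hkn : k < n := by omega
      obtain ⟨y, hy, hxy⟩ := hx.exists_eq hk
      have htop : topRel (π x) k (k + 1) := hxy ▸ hv.topRel_self_succ hkn y
      have hx₁ : v k * x = x := by rw [hxy, ← mul_assoc, hv.idem _ hkn]
      by_cases h₀ : k = 0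
      · subst h₀
        have h₂ : 0 < m → topRel (π x) 2 0 := by
          intro hm0
          obtain ⟨z, hz, rfl⟩ := hy.exists_eq (by omega)
          subst hxy
          exact hv.topRel_of_link hkn (.inl rfl) (.inr (.inr
            ⟨(hv.topRel_self_succ (by omega) z).symm, topRel.refl (by omega)⟩))
        refine hook _ 0 rfl (by omega) x hx.mem x' hx' hx₁
          (hv.mul_eq_of_zero_one hm hx' (hπ ▸ htop.symm))
          (fun h => hv.mul_eq_of_zero_two hm hx.mem (h₂ h))
          (fun h => hv.mul_eq_of_zero_two hm hx' (hπ ▸ h₂ h)) hπ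
      · have hx₁' : v k * x' = x' := by
          refine hv.mul_eq_of_hook hm hx' h₀ (hπ ▸ htop) ?_
          rw [← hπ, hxy]
          intro h
          have := hv.eq_of_topRel hkn h₀ (.inl rfl) h
          omega
        have hback : ∀ z, v k * z = z → k < m → v k * (v (k + 1) * z) = z := by
          intro z hz hkm
          conv_lhs => rw [← hz]
          rw [← mul_assoc, ← mul_assoc, hv.jones_down k h₀ (by omega), hz]
        exact hook _ k rfl (by omega) x hx.mem x' hx' hx₁ hx₁' (hback x hx₁) (hback x' hx₁') hπ
    intro x x' hx hx' hπ
    obtain ⟨k, hk⟩ := hv.exists_run hm hx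
    obtain ⟨k', hk'⟩ := hv.exists_run hm hx'
    rcases hk.le.eq_or_lt with rfl | hlt
    · rcases hk'.le.eq_or_lt with rfl | hlt
      · exact IH hmn.le hk.mem_of_eq hk'.mem_of_eq hπ
      · exact (main hk' hlt hx hπ.symm).symm
    · exact main hk hlt hx' hπ

end IsHookFamily

/-! ### Blocks of hook diagrams -/

/-- In a hook diagram, a block that does not contain the point `0` has exactly two points. -/
theorem HookBlob.exists_partner {n : ℕ} {D : PartitionDiagram (Fin (n + 1))}
    (hD : D ∈ HookBlob n) : ∀ p, ¬ D.rel p (.inl 0) → ∃ q ≠ p, ∀ r, D.rel p r ↔ r = p ∨ r = q := by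
  refine Submonoid.closure_induction_left (motive := fun D _ =>
    ∀ p, ¬ D.rel p (.inl 0) → ∃ q ≠ p, ∀ r, D.rel p r ↔ r = p ∨ r = q) ?_ ?_ hD
  · rintro (k | k) -
    · refine ⟨.inr k, by simp, ?_⟩
      rintro (r | r) <;> simp [eq_comm]
    · refine ⟨.inl k, by simp, ?_⟩
      rintro (r | r) <;> simp [eq_comm]
  · rintro _ ⟨i, rfl⟩ D - ih p hp
    have hne : i.castSucc ≠ i.succ := (Fin.castSucc_lt_succ).ne
    by_cases hi : i.val = 0
    · have h0 : i.castSucc = 0 := by simp [Fin.ext_iff, hi]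
      simp only [hookGen_zero_mul_rel hi, link_rel, h0] at hp ⊢
      have hr : ∀ x, D.rel x x := fun x => Setoid.refl' _ x
      obtain ⟨q, hq, h⟩ := ih p fun h => hp (.inl h)
      refine ⟨q, hq, fun r => ?_⟩
      rw [← h]
      have := hr (.inl 0)
      tauto
    · simp only [hookGen_mul_rel hi, link_rel] at hp ⊢
      by_cases hpe : IsHookEnd i p
      · rcases hpe with rfl | rfl
        · refine ⟨.inl i.succ, by simpa using hne.symm, fun r => ?_⟩
          simp [IsHookEnd]
        · refine ⟨.inl i.castSucc, by simpa using hne, fun r => ?_⟩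
          simp [IsHookEnd, or_comm]
      · have h0 : ¬ IsHookEnd i (.inl 0) := by
          simp [IsHookEnd, Fin.ext_iff]
          omega
        have hs : ∀ {x y}, D.rel x y ↔ D.rel y x :=
          ⟨fun h => Setoid.symm' _ h, fun h => Setoid.symm' _ h⟩
        have ht : ∀ {x y z}, D.rel x y → D.rel y z → D.rel x z := Setoid.trans' _
        have hr : ∀ x, D.rel x x := fun x => Setoid.refl' _ x
        simp only [hpe, h0, false_and, not_false_eq_true, true_and, false_or] at hp ⊢
        obtain ⟨q, hq, h⟩ := ih p fun h => hp (.inl h)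
        -- If `p` was joined to one end of the arc `{i, i + 1}`, it is now joined to the
        -- former partner of the other end.
        have key : ∀ a b : Fin (n + 1) ⊕ Fin (n + 1), a ≠ b → p ≠ a → p ≠ b →
            (∀ x, IsHookEnd i x ↔ x = a ∨ x = b) → ¬ (D.rel p a ∧ D.rel b (.inl 0)) → q = a →
            ∃ q ≠ p, ∀ r, ¬ IsHookEnd i r ∧
              (D.rel p r ∨ (D.rel p a ∧ D.rel b r) ∨ (D.rel p b ∧ D.rel a r)) ↔
              r = p ∨ r = q := by
          rintro a b hab hpa hpb he h0 rfl
          have hpq : D.rel p q := (h q).2 (.inr rfl)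
          obtain ⟨u, hu, hu'⟩ := ih b fun hb => h0 ⟨hpq, hb⟩
          have hpb' : ¬ D.rel p b := by rw [h]; grind
          have hup : u ≠ p := by
            rintro rfl
            exact hpb' (hs.1 ((hu' _).2 (.inr rfl)))
          have huq : u ≠ q := by
            rintro rfl
            exact hpb' (ht hpq (hs.1 ((hu' _).2 (.inr rfl))))
          refine ⟨u, hup, fun r => ?_⟩
          simp only [he, hpq, hpb', h, hu', true_and, false_and, or_false]
          clear ih hs ht hr h hp hu' he h0 hpq hpb'
          grind
        simp only [IsHookEnd, not_or] at hpe
        by_cases hqa : q = .inl i.castSucc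
        · exact key _ _ (by simpa using hne) hpe.1 hpe.2 (fun _ => Iff.rfl) (by tauto) hqa
        · by_cases hqb : q = .inl i.succ
          · obtain ⟨u, hu, hu'⟩ := key (.inl i.succ) (.inl i.castSucc) (by simpa using hne.symm)
              hpe.2 hpe.1 (fun _ => or_comm) (by tauto) hqb
            refine ⟨u, hu, fun r => (Iff.trans ?_ (hu' r))⟩
            tauto
          · refine ⟨q, hq, fun r => ?_⟩
            simp only [h, IsHookEnd]
            clear key ih hs ht hr h hp
            grind

/-! ### The connected framed blob monoid -/

namespace ConnectedFramedBlob

variable {d n : ℕ}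

/-- The generator `u_i` of the connected framed blob monoid. -/
def u (d : ℕ) (i : Fin n) : ConnectedFramedBlob d n :=
  PresentedMonoid.of (ConnectedFramedBlobRel d n) (.u i)

/-- The generator `z_j` of the connected framed blob monoid. -/
def z (d : ℕ) (j : Fin (n + 1)) : ConnectedFramedBlob d n :=
  PresentedMonoid.of (ConnectedFramedBlobRel d n) (.z j)

theorem mk_U (i : Fin n) :
    PresentedMonoid.mk (ConnectedFramedBlobRel d n) (BlobGen.U i) = u d i := rfl

theorem mk_Z (j : Fin (n + 1)) :
    PresentedMonoid.mk (ConnectedFramedBlobRel d n) (BlobGen.Z j) = z d j := rfl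

theorem mk_eq {a b : FreeMonoid (BlobGen n)} (h : ConnectedFramedBlobRel d n a b) :
    PresentedMonoid.mk (ConnectedFramedBlobRel d n) a = PresentedMonoid.mk _ b :=
  PresentedMonoid.mk_eq_mk_of_rel h

theorem z_pow (j : Fin (n + 1)) : z d j ^ d = 1 := by
  simpa only [map_pow, map_one, mk_Z] using mk_eq (.z_pow j)

theorem z_comm (j k : Fin (n + 1)) : z d j * z d k = z d k * z d j := by
  simpa only [map_mul, mk_Z] using mk_eq (.z_comm j k)

theorem z_slide_left (i : Fin n) : z d i.castSucc * u d i = z d i.succ * u d i := by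
  simpa only [map_mul, mk_Z, mk_U] using mk_eq (d := d) (.z_slide_left i)

theorem z_slide_right (i : Fin n) : u d i * z d i.castSucc = u d i * z d i.succ := by
  simpa only [map_mul, mk_Z, mk_U] using mk_eq (d := d) (.z_slide_right i)

theorem u_z_comm (i : Fin n) (j : Fin (n + 1)) (h : j ≠ i.castSucc) (h' : j ≠ i.succ) :
    u d i * z d j = z d j * u d i := by
  simpa only [map_mul, mk_Z, mk_U] using mk_eq (d := d) (.u_z_comm i j h h')

theorem z_zero_u_zero (i : Fin n) (hi : i.val = 0) :
    z d i.castSucc * u d i = u d i * z d i.castSucc := by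
  have h0 : i.castSucc = 0 := by simp [Fin.ext_iff, hi]
  rw [h0]
  simpa only [map_mul, mk_Z, mk_U] using mk_eq (d := d) (.z_zero_u_zero i hi)

theorem u_loop (i : Fin n) (hi : i.val ≠ 0) (k : ℕ) :
    u d i * z d i.castSucc ^ k * u d i = u d i := by
  simpa only [map_mul, map_pow, mk_Z, mk_U] using mk_eq (d := d) (.u_loop i hi k)

/-- The blob generators as a family indexed by `ℕ`, extended by `1`. -/
def blob (d n k : ℕ) : ConnectedFramedBlob d n := if h : k < n then u d ⟨k, h⟩ else 1

theorem blob_of_lt {k : ℕ} (h : k < n) : blob d n k = u d ⟨k, h⟩ := dif_pos h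

/-- The diagram of an element, without its beads. -/
noncomputable def shape (d n : ℕ) : ConnectedFramedBlob d n →* PartitionDiagram (Fin (n + 1)) :=
  baseHom.comp ((AbacusHook d n).subtype.comp (abacusHom d n))

theorem shape_mem_hookBlob (m : ConnectedFramedBlob d n) : shape d n m ∈ HookBlob n :=
  (abacusHom d n m).2

theorem isHookFamily (d n : ℕ) : IsHookFamily n (blob d n) (shape d n) where
  idem i hi := by
    rw [blob_of_lt hi]
    simpa only [map_mul, mk_U] using mk_eq (d := d) (.u_idem ⟨i, hi⟩)
  comm i j h hj := by
    rw [blob_of_lt (by omega : i < n), blob_of_lt hj]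
    simpa only [map_mul, mk_U] using
      mk_eq (d := d) (.u_comm ⟨i, by omega⟩ ⟨j, hj⟩ (.inl h))
  jones_up i hi := by
    rw [blob_of_lt (by omega : i < n), blob_of_lt hi]
    by_cases h0 : i = 0
    · simpa only [map_mul, mk_U] using
        mk_eq (d := d) (.u_one_zero_one ⟨i + 1, hi⟩ ⟨i, by omega⟩ (by simpa using h0) h0)
    · simpa only [map_mul, mk_U] using
        mk_eq (d := d) (.u_jones ⟨i + 1, hi⟩ ⟨i, by omega⟩ (by simp) h0 (.inl rfl))
  jones_down i h0 hi := by
    rw [blob_of_lt (by omega : i < n), blob_of_lt hi]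
    simpa only [map_mul, mk_U] using
      mk_eq (d := d) (.u_jones ⟨i, by omega⟩ ⟨i + 1, hi⟩ h0 (by simp) (.inr rfl))
  map i hi := by
    rw [blob_of_lt hi]
    rfl

/-- The element `m` with one more bead, at the upper point `j` for `p = Sum.inl j` and at the
lower point `j` for `p = Sum.inr j`. -/
def addBead (p : Fin (n + 1) ⊕ Fin (n + 1)) (m : ConnectedFramedBlob d n) :
    ConnectedFramedBlob d n :=
  p.elim (fun j => z d j * m) fun j => m * z d j

theorem addBead_inl (j : Fin (n + 1)) (m : ConnectedFramedBlob d n) :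
    addBead (.inl j) m = z d j * m := rfl

theorem addBead_inr (j : Fin (n + 1)) (m : ConnectedFramedBlob d n) :
    addBead (.inr j) m = m * z d j := rfl

instance : LeftCommutative (addBead (d := d) (n := n)) where
  left_comm p q m := by
    rcases p with j | j <;> rcases q with k | k <;>
      simp only [addBead_inl, addBead_inr]
    · rw [← mul_assoc, z_comm, mul_assoc]
    · rw [mul_assoc]
    · rw [mul_assoc]
    · rw [mul_assoc, z_comm, ← mul_assoc]

/-- The element `m` with one more bead at each of the points in `s`. -/
def addBeads (s : Multiset (Fin (n + 1) ⊕ Fin (n + 1))) (m : ConnectedFramedBlob d n) :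
    ConnectedFramedBlob d n :=
  s.foldr addBead m

theorem addBeads_zero (m : ConnectedFramedBlob d n) : addBeads 0 m = m := rfl

theorem addBeads_cons (p : Fin (n + 1) ⊕ Fin (n + 1)) (s : Multiset (Fin (n + 1) ⊕ Fin (n + 1)))
    (m : ConnectedFramedBlob d n) : addBeads (p ::ₘ s) m = addBead p (addBeads s m) :=
  Multiset.foldr_cons _ _ _ _

theorem addBeads_add (s t : Multiset (Fin (n + 1) ⊕ Fin (n + 1)))
    (m : ConnectedFramedBlob d n) : addBeads (s + t) m = addBeads s (addBeads t m) :=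
  Multiset.foldr_add _ _ _ _

theorem addBead_addBeads (p : Fin (n + 1) ⊕ Fin (n + 1))
    (s : Multiset (Fin (n + 1) ⊕ Fin (n + 1))) (m : ConnectedFramedBlob d n) :
    addBead p (addBeads s m) = addBeads s (addBead p m) := by
  induction s using Multiset.induction_on with
  | empty => rfl
  | cons q s ih =>
    rw [addBeads_cons, addBeads_cons, ← ih, LeftCommutative.left_comm (op := addBead)]

theorem pow_mul_eq_addBeads (j : Fin (n + 1)) (k : ℕ) (m : ConnectedFramedBlob d n) :
    z d j ^ k * m = addBeads (.replicate k (.inl j)) m := by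
  induction k with
  | zero => rw [pow_zero, one_mul, Multiset.replicate_zero, addBeads_zero]
  | succ k ih => rw [pow_succ', mul_assoc, ih, Multiset.replicate_succ, addBeads_cons, addBead_inl]

/-! ### Beads slide along blocks -/

/-- The labels of `hookGen i` are chosen such that a bead can be moved from each point to its
label. -/
theorem addBead_hookLabel (i : Fin n) (p : Fin (n + 1) ⊕ Fin (n + 1)) :
    addBead (hookLabel i p) (u d i) = addBead p (u d i) := by
  rcases p with k | k <;> simp only [hookLabel]
  · split_ifs with h
    · rw [h, addBead_inl, addBead_inl, z_slide_left]
    · rfl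
  · split_ifs with h h₀
    · rw [addBead_inl, z_zero_u_zero i h₀, addBead_inr]
      rcases h with rfl | rfl
      · rfl
      · exact z_slide_right i
    · rw [addBead_inr, addBead_inr]
      rcases h with rfl | rfl
      · rfl
      · exact z_slide_right i
    · rw [addBead_inl, addBead_inr, u_z_comm i k (by tauto) (by tauto)]

/-- Beads may be moved between any two points in the same block. -/
theorem addBead_congr {x : ConnectedFramedBlob d n} (hx : x ∈ genBelow (blob d n) n) :
    ∀ {p q}, (shape d n x).rel p q → addBead p x = addBead q x := by
  refine genBelow_induction (p := fun x =>
    ∀ {p q}, (shape d n x).rel p q → addBead p x = addBead q x) ?_ ?_ hx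
  · intro p q h
    rw [map_one, one_rel] at h
    have key : ∀ p : Fin (n + 1) ⊕ Fin (n + 1),
        addBead p (1 : ConnectedFramedBlob d n) = z d (Sum.elim id id p) := by
      rintro (k | k)
      · exact mul_one _
      · exact one_mul _
    rw [key, key, h]
  · intro i hi x _ ih p q h
    rw [(isHookFamily d n).map_mul hi, mul_rel] at h
    rw [blob_of_lt hi]
    -- the function that puts a bead on a point in one of the three layers of the stack
    let φ : Fin (n + 1) ⊕ Fin (n + 1) ⊕ Fin (n + 1) → ConnectedFramedBlob d n :=
      Sum.elim (fun j => z d j * u d ⟨i, hi⟩ * x) (Sum.elim (fun j => u d ⟨i, hi⟩ * z d j * x)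
        fun j => u d ⟨i, hi⟩ * x * z d j)
    have hupper : ∀ p, φ (upper p) = addBead p (u d ⟨i, hi⟩) * x := by
      rintro (k | k) <;> rfl
    have hlower : ∀ p, φ (lower p) = u d ⟨i, hi⟩ * addBead p x := by
      rintro (k | k)
      · exact mul_assoc _ _ _
      · exact mul_assoc _ _ _
    have houter : ∀ p, φ (outer p) = addBead p (u d ⟨i, hi⟩ * x) := by
      rintro (k | k)
      · exact mul_assoc _ _ _
      · rfl
    rw [← houter, ← houter]
    refine stack_ker φ ?_ ?_ h
    · intro v w hvw
      rw [hupper, hupper, ← addBead_hookLabel, hookGen_rel.1 hvw, addBead_hookLabel]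
    · intro v w hvw
      rw [hlower, hlower, ih hvw]

/-! ### Every element consists of a diagram and beads -/

theorem u_mul_addBead {i : Fin n} {p : Fin (n + 1) ⊕ Fin (n + 1)} (h : ¬ IsHookEnd i p)
    (m : ConnectedFramedBlob d n) : u d i * addBead p m = addBead p (u d i * m) := by
  rcases p with k | k
  · simp only [IsHookEnd, Sum.inl.injEq, not_or] at h
    rw [addBead_inl, addBead_inl, ← mul_assoc, u_z_comm i k h.1 h.2, mul_assoc]
  · rw [addBead_inr, addBead_inr, mul_assoc]

/-- Beads at the two ends of the arc of `u d i` are interchangeable. -/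
theorem u_mul_addBead_of_isHookEnd {i : Fin n} {p : Fin (n + 1) ⊕ Fin (n + 1)}
    (h : IsHookEnd i p) (m : ConnectedFramedBlob d n) :
    u d i * addBead p m = u d i * (z d i.castSucc * m) := by
  rcases h with rfl | rfl
  · rfl
  · rw [addBead_inl, ← mul_assoc, ← z_slide_right, mul_assoc]

/-- If a bead at either end of the arc of `u d i` can be moved past `u d i`, whatever other beads
there are, then all beads can. -/
theorem exists_u_mul_addBeads_of_forall {i : Fin n} {x : ConnectedFramedBlob d n}
    (h : ∀ p, IsHookEnd i p → ∃ q, ∀ s, u d i * addBead p (addBeads s x) =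
      addBead q (u d i * addBeads s x)) (s : Multiset (Fin (n + 1) ⊕ Fin (n + 1))) :
    ∃ s', u d i * addBeads s x = addBeads s' (u d i * x) := by
  induction s using Multiset.induction_on with
  | empty => exact ⟨0, rfl⟩
  | cons p s ih =>
    obtain ⟨s', hs'⟩ := ih
    rw [addBeads_cons]
    by_cases hp : IsHookEnd i p
    · obtain ⟨q, hq⟩ := h p hp
      exact ⟨q ::ₘ s', by rw [hq, hs', addBeads_cons]⟩
    · exact ⟨p ::ₘ s', by rw [u_mul_addBead hp, hs', addBeads_cons]⟩

/-- The beads of an element can be moved past a generator. Those that would end up on a closed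
component are erased. -/
theorem exists_u_mul_addBeads (i : Fin n) {x : ConnectedFramedBlob d n}
    (hx : x ∈ genBelow (blob d n) n) (s : Multiset (Fin (n + 1) ⊕ Fin (n + 1))) :
    ∃ s', u d i * addBeads s x = addBeads s' (u d i * x) := by
  by_cases hi : i.val = 0
  · refine exists_u_mul_addBeads_of_forall (fun p hp => ⟨.inl i.castSucc, fun s => ?_⟩) s
    rw [u_mul_addBead_of_isHookEnd hp, addBead_inl, ← mul_assoc, ← z_zero_u_zero i hi, mul_assoc]
  by_cases hesc : ∃ p e, IsHookEnd i e ∧ ¬ IsHookEnd i p ∧ (shape d n x).rel e p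
  · obtain ⟨p, e, he, hp, hep⟩ := hesc
    refine exists_u_mul_addBeads_of_forall (fun a ha => ⟨p, fun s => ?_⟩) s
    rw [u_mul_addBead_of_isHookEnd ha, ← u_mul_addBead_of_isHookEnd he, addBead_addBeads,
      addBead_congr hx hep, ← addBead_addBeads, u_mul_addBead hp]
  · -- Here `{i, i + 1}` is a block of `x`, and the loop that it closes with `u d i` is erased.
    push Not at hesc
    have hne : i.castSucc ≠ i.succ := (Fin.castSucc_lt_succ).ne
    have h0 : ¬ IsHookEnd i (.inl 0) := by
      simp [IsHookEnd, Fin.ext_iff]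
      omega
    have hc : ¬ (shape d n x).rel (.inl i.castSucc) (.inl 0) := hesc _ _ (.inl rfl) h0
    obtain ⟨q, hq, hq'⟩ :=
      HookBlob.exists_partner (shape_mem_hookBlob x) (.inl i.castSucc) hc
    have hrel : (shape d n x).rel (.inl i.castSucc) (.inl i.succ) := by
      have h₁ := (hq' q).2 (.inr rfl)
      have h₂ : IsHookEnd i q := by
        by_contra h
        exact hesc _ _ (.inl rfl) h h₁
      rcases h₂ with rfl | rfl
      · exact absurd rfl hq
      · exact h₁
    have hux : u d i * x = x := by
      have := (isHookFamily d n).mul_eq_of_hook le_rfl hx hi ⟨by omega, by omega, hrel⟩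
        fun ⟨_, _, h⟩ => hc h
      rwa [blob_of_lt i.isLt] at this
    have key : ∀ s k, ∃ s', u d i * (z d i.castSucc ^ k * addBeads s x) = addBeads s' x := by
      intro s
      induction s using Multiset.induction_on with
      | empty =>
        intro k
        refine ⟨0, ?_⟩
        rw [addBeads_zero]
        conv_lhs => rw [← hux]
        rw [← mul_assoc, ← mul_assoc, u_loop i hi, hux]
      | cons p s ih =>
        intro k
        rw [addBeads_cons]
        by_cases hp : IsHookEnd i p
        · obtain ⟨s', hs'⟩ := ih (k + 1)
          refine ⟨s', ?_⟩
          rw [← hs', pow_mul_eq_addBeads, ← addBead_addBeads, u_mul_addBead_of_isHookEnd hp,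
            ← pow_mul_eq_addBeads, ← mul_assoc (z d _), ← pow_succ']
        · obtain ⟨s', hs'⟩ := ih k
          refine ⟨p ::ₘ s', ?_⟩
          rw [pow_mul_eq_addBeads, ← addBead_addBeads, u_mul_addBead hp, ← pow_mul_eq_addBeads, hs',
            addBeads_cons]
    obtain ⟨s', hs'⟩ := key s 0
    rw [pow_zero, one_mul] at hs'
    exact ⟨s', by rw [hs', hux]⟩

/-- Every element arises by adding beads to a product of blob generators. -/
theorem exists_eq_addBeads (m : ConnectedFramedBlob d n) :
    ∃ x ∈ genBelow (blob d n) n, ∃ s, m = addBeads s x := by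
  have hm : m ∈ Submonoid.closure
      (Set.range (PresentedMonoid.of (ConnectedFramedBlobRel d n))) := by
    rw [PresentedMonoid.closure_range_of]
    trivial
  refine Submonoid.closure_induction_left (motive := fun m _ =>
    ∃ x ∈ genBelow (blob d n) n, ∃ s, m = addBeads s x) ⟨1, one_mem _, 0, rfl⟩ ?_ hm
  rintro _ ⟨i | j, rfl⟩ _ - ⟨x, hx, s, rfl⟩
  · obtain ⟨s', hs'⟩ := exists_u_mul_addBeads i hx s
    refine ⟨u d i * x, mul_mem ?_ hx, s', hs'⟩
    rw [show u d i = blob d n i.val from (blob_of_lt i.isLt).symm]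
    exact mem_genBelow i.isLt
  · exact ⟨x, hx, .inl j ::ₘ s, by rw [addBeads_cons, addBead_inl]; rfl⟩

/-! ### Only the number of beads on each block matters, modulo `d` -/

theorem addBeads_replicate_congr {a b : ℕ} (h : (a : ZMod d) = b)
    (p : Fin (n + 1) ⊕ Fin (n + 1)) (m : ConnectedFramedBlob d n) :
    addBeads (.replicate a p) m = addBeads (.replicate b p) m := by
  rw [ZMod.natCast_eq_natCast_iff] at h
  have hpow : ∀ j : Fin (n + 1), z d j ^ a = z d j ^ b := fun j =>
    pow_eq_pow_of_modEq h (z_pow j)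
  rcases p with j | j
  · rw [← pow_mul_eq_addBeads, ← pow_mul_eq_addBeads, hpow]
  · have key : ∀ k, addBeads (.replicate k (.inr j)) m = m * z d j ^ k := by
      intro k
      induction k with
      | zero => rw [pow_zero, mul_one, Multiset.replicate_zero, addBeads_zero]
      | succ k ih =>
        rw [pow_succ, ← mul_assoc, ← ih, Multiset.replicate_succ, addBeads_cons, addBead_inr]
    rw [key, key, hpow]

open scoped Classical in
theorem addBeads_congr_of_count {s t : Multiset (Fin (n + 1) ⊕ Fin (n + 1))}
    (h : ∀ p, (s.count p : ZMod d) = t.count p) (m : ConnectedFramedBlob d n) :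
    addBeads s m = addBeads t m := by
  have hsum : ∀ s : Multiset (Fin (n + 1) ⊕ Fin (n + 1)),
      ∑ p, Multiset.replicate (s.count p) p = s := by
    intro s
    ext q
    simp only [Multiset.count_sum', Multiset.count_replicate, Finset.sum_ite_eq', Finset.mem_univ,
      if_true]
  have key : ∀ F : Finset (Fin (n + 1) ⊕ Fin (n + 1)),
      addBeads (∑ p ∈ F, Multiset.replicate (s.count p) p) m =
        addBeads (∑ p ∈ F, Multiset.replicate (t.count p) p) m := by
    intro F
    induction F using Finset.induction_on with
    | empty => rfl
    | insert p F hp ih =>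
      rw [Finset.sum_insert hp, Finset.sum_insert hp, addBeads_add, addBeads_add, ih,
        addBeads_replicate_congr (h p)]
  rw [← hsum s, ← hsum t]
  exact key _

open scoped Classical in
theorem addBeads_congr {x : ConnectedFramedBlob d n} (hx : x ∈ genBelow (blob d n) n)
    {s t : Multiset (Fin (n + 1) ⊕ Fin (n + 1))}
    (h : ∀ b, (s.countP ((shape d n x).block · = b) : ZMod d) =
      t.countP ((shape d n x).block · = b)) :
    addBeads s x = addBeads t x := by
  -- a representative of the block of each point
  let ρ : Fin (n + 1) ⊕ Fin (n + 1) → Fin (n + 1) ⊕ Fin (n + 1) := fun p =>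
    Quotient.out ((shape d n x).block p)
  have hρ : ∀ p, (shape d n x).block (ρ p) = (shape d n x).block p := fun p =>
    Quotient.out_eq ((shape d n x).block p)
  have hmap : ∀ s, addBeads s x = addBeads (s.map ρ) x := by
    intro s
    induction s using Multiset.induction_on with
    | empty => rfl
    | cons p s ih =>
      rw [Multiset.map_cons, addBeads_cons, addBeads_cons, ← ih, addBead_addBeads,
        addBead_addBeads, addBead_congr hx (block_eq.1 (hρ p).symm)]
  rw [hmap s, hmap t]
  refine addBeads_congr_of_count (fun q => ?_) x
  by_cases hq : ρ q = q
  · have hcount : ∀ s : Multiset (Fin (n + 1) ⊕ Fin (n + 1)), (s.map ρ).count q =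
        s.countP ((shape d n x).block · = (shape d n x).block q) := by
      intro s
      rw [Multiset.count_map, ← Multiset.countP_eq_card_filter]
      refine Multiset.countP_congr rfl fun p _ => propext ⟨fun h => ?_, fun h => ?_⟩
      · rw [h, hρ]
      · rw [← hq]
        exact congrArg Quotient.out h.symm
    rw [hcount, hcount, h]
  · have hcount : ∀ s : Multiset (Fin (n + 1) ⊕ Fin (n + 1)), (s.map ρ).count q = 0 := by
      intro s
      rw [Multiset.count_eq_zero, Multiset.mem_map]
      rintro ⟨p, -, rfl⟩
      exact hq (congrArg Quotient.out (hρ p))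
    rw [hcount, hcount]

/-! ### Comparison with beaded diagrams -/

open scoped Classical in
/-- The diagram `P` with one bead at each of the points in `s`. -/
noncomputable def beaded (d : ℕ) (P : PartitionDiagram (Fin (n + 1)))
    (s : Multiset (Fin (n + 1) ⊕ Fin (n + 1))) : BeadedDiagram (Fin (n + 1)) (ZMod d) :=
  ⟨P, fun b => s.countP (P.block · = b)⟩

theorem coe_abacusHom_blob {x : ConnectedFramedBlob d n} (hx : x ∈ genBelow (blob d n) n) :
    (abacusHom d n x : BeadedDiagram (Fin (n + 1)) (ZMod d)) = bare (shape d n x) := by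
  refine genBelow_induction (p := fun x => (abacusHom d n x :
    BeadedDiagram (Fin (n + 1)) (ZMod d)) = bare (shape d n x)) ?_ ?_ hx
  · rw [map_one, map_one]
    rfl
  · intro i hi x _ ih
    rw [map_mul, Submonoid.coe_mul, ih, (isHookFamily d n).map_mul hi, blob_of_lt hi, ← bare_mul]
    rfl

theorem coe_abacusHom_addBeads {x : ConnectedFramedBlob d n} (hx : x ∈ genBelow (blob d n) n)
    (s : Multiset (Fin (n + 1) ⊕ Fin (n + 1))) :
    (abacusHom d n (addBeads s x) : BeadedDiagram (Fin (n + 1)) (ZMod d)) =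
      beaded d (shape d n x) s := by
  classical
  induction s using Multiset.induction_on with
  | empty =>
    rw [addBeads_zero, coe_abacusHom_blob hx]
    exact ext' rfl fun v => by simp [bare, beaded]
  | cons p s ih =>
    rw [addBeads_cons]
    have hz : ∀ j, (abacusHom d n (z d j) : BeadedDiagram (Fin (n + 1)) (ZMod d)) =
      single 1 (.inl j) 1 := fun _ => rfl
    rcases p with j | j
    · rw [addBead_inl, map_mul, Submonoid.coe_mul, ih, hz]
      refine ext' (one_mul _) fun v => (single_one_mul_beads j 1 _ v).trans ?_
      simp only [beaded, Multiset.countP_cons, block_eq, Nat.cast_add, Nat.cast_ite, Nat.cast_one,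
        Nat.cast_zero]
      rfl
    · rw [addBead_inr, map_mul, Submonoid.coe_mul, ih, hz]
      refine ext' (mul_one _) fun v => (mul_single_one_beads j 1 _ v).trans ?_
      simp only [beaded, Multiset.countP_cons, block_eq, Nat.cast_add, Nat.cast_ite, Nat.cast_one,
        Nat.cast_zero]
      rfl

theorem abacusHom_injective (d n : ℕ) : Function.Injective (abacusHom d n) := by
  intro m m' h
  obtain ⟨x, hx, s, rfl⟩ := exists_eq_addBeads m
  obtain ⟨x', hx', s', rfl⟩ := exists_eq_addBeads m'
  have h₁ := congrArg (Subtype.val) h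
  rw [coe_abacusHom_addBeads hx, coe_abacusHom_addBeads hx'] at h₁
  have h₂ := congrArg BeadedDiagram.base h₁
  obtain rfl : x = x' := (isHookFamily d n).eq_of_map_eq le_rfl hx hx' h₂
  refine addBeads_congr hx fun b => ?_
  have h₃ := (BeadedDiagram.mk.injEq _ _ _ _ ▸ h₁ : _ ∧ _).2
  exact congrFun (eq_of_heq h₃) b

theorem exists_shape_eq {P : PartitionDiagram (Fin (n + 1))} (hP : P ∈ HookBlob n) :
    ∃ x ∈ genBelow (blob d n) n, shape d n x = P := by
  refine Submonoid.closure_induction_left (motive := fun P _ =>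
    ∃ x ∈ genBelow (blob d n) n, shape d n x = P) ⟨1, one_mem _, map_one _⟩ ?_ hP
  rintro _ ⟨i, rfl⟩ _ - ⟨x, hx, rfl⟩
  exact ⟨blob d n i.val * x, mul_mem (mem_genBelow i.isLt) hx,
    (isHookFamily d n).map_mul i.isLt x⟩

theorem abacusHom_surjective (d n : ℕ) [NeZero d] : Function.Surjective (abacusHom d n) := by
  classical
  rintro ⟨⟨P, f⟩, hP⟩
  obtain ⟨x, hx, rfl⟩ := exists_shape_eq (d := d) hP
  choose rep hrep using (shape d n x).block_surjective
  refine ⟨addBeads (∑ b, Multiset.replicate (f b).val (rep b)) x,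
    Subtype.ext ((coe_abacusHom_addBeads hx _).trans ?_)⟩
  refine congrArg (BeadedDiagram.mk _) (funext fun c => ?_)
  have hcount := map_sum (Multiset.countPAddMonoidHom ((shape d n x).block · = c))
    (fun b => Multiset.replicate (f b).val (rep b)) Finset.univ
  have hreplicate : ∀ b, (Multiset.replicate (f b).val (rep b)).countP
      ((shape d n x).block · = c) = if b = c then (f b).val else 0 := by
    intro b
    rw [← Multiset.coe_replicate, Multiset.coe_countP, List.countP_replicate]
    simp [hrep]
  simp only [Multiset.coe_countPAddMonoidHom, hreplicate, Finset.sum_ite_eq', Finset.mem_univ,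
    if_true] at hcount
  exact (congrArg Nat.cast hcount).trans (ZMod.natCast_zmod_val _)

end ConnectedFramedBlob

theorem mainTheorem10 (d n : ℕ) (hd : 0 < d) (hn : 0 < n) :
    (∃ ψ : ConnectedFramedBlob d n →* AbacusHook d n,
      (∀ j : Fin (n + 1),
        ψ (PresentedMonoid.of (ConnectedFramedBlobRel d n) (.z j)) = AbacusHook.z d j) ∧
      (∀ i : Fin n,
        ψ (PresentedMonoid.of (ConnectedFramedBlobRel d n) (.u i)) = AbacusHook.u d i) ∧
      Function.Bijective ψ) ∧
    Submonoid.closure (Set.range (AbacusHook.gen d n)) = ⊤ ∧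
    Con.ker (FreeMonoid.lift (AbacusHook.gen d n)) = conGen (ConnectedFramedBlobRel d n) := by
  have : NeZero d := ⟨hd.ne'⟩
  have hinj := ConnectedFramedBlob.abacusHom_injective d n
  have hsurj := ConnectedFramedBlob.abacusHom_surjective d n
  refine ⟨⟨abacusHom d n, fun _ => rfl, fun _ => rfl, hinj, hsurj⟩, ?_, ?_⟩
  · have hrange : Set.range (AbacusHook.gen d n) =
        abacusHom d n '' Set.range (PresentedMonoid.of (ConnectedFramedBlobRel d n)) := by
      rw [← Set.range_comp]
      rfl
    rw [hrange, ← MonoidHom.map_mclosure, PresentedMonoid.closure_range_of,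
      ← MonoidHom.mrange_eq_map, MonoidHom.mrange_eq_top.2 hsurj]
  · ext a b
    rw [Con.ker_rel, ← PresentedMonoid.mk_eq_mk_iff, ← hinj.eq_iff]
    rfl
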